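/- Let $\rho:[0,\infty)\to\mathbb{R}$ be the Dickman--de Bruijn function, i.e. the unique continuous function with $\rho(u)=1$ for $0\le u\le 1$ and $u\rho'(u)+\rho(u-1)=0$ for $u>1$. For $z\in\mathbb{C}$ with $|z|=1$, let $\arg(z)$ denote the element of $(-1/2,1/2]$ with $z=e^{2\pi i\arg(z)}$. Let $g:\mathbb{N}\to\mathbb{R}$ be any function with $$g(q)=o\Big(\frac{\log\log q}{\log\log\log q}\Big)\qquad (q\to\infty).$$ Then there is $q_0=q_0(g)$ such that the following holds for every prime $q\ge q_0$. Let $\delta\in(0,1/2)$ satisfy $1/\delta\le g(q)$, let $d\ge 2$, and let $\chi$ be a primitive Dirichlet character modulo $q$ of order $d$, where $d>\rho(1/\delta)^{-1}$. Then for any $c>1$ there is an integer $1\le n\le q^{\delta}$ with $$|\arg(\chi(n))|\ \ge\ \max\Big\{\frac1d,\ \rho(1/\delta)^{c}\Big\}.$$ -/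

import Mathlib

open Filter Asymptotics

/-- Method-of-steps approximations to the Dickman--de Bruijn function: `dickmanStep n` is
continuous on `ℝ`, and it agrees with the Dickman--de Bruijn function on `[0, n + 1]`. -/
noncomputable def dickmanStep : ℕ → ℝ → ℝ
  | 0 => fun _ => 1
  | n + 1 => fun u => 1 - ∫ t in (1 : ℝ)..max 1 u, dickmanStep n (t - 1) / t

/-- The Dickman--de Bruijn function: the unique continuous function on `[0, ∞)` with
`ρ u = 1` for `0 ≤ u ≤ 1` and `u ρ'(u) + ρ(u - 1) = 0` for `u > 1`
(see `dickmanRho_spec` and `dickmanRho_unique` below). -/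
noncomputable def dickmanRho (u : ℝ) : ℝ := dickmanStep ⌈u⌉₊ u

/-- For `‖z‖ = 1`, the element `θ` of `(-1/2, 1/2]` such that `z = e^{2πiθ}`
(see `unitArg_mem` and `exp_unitArg` below). -/
noncomputable def unitArg (z : ℂ) : ℝ := Complex.arg z / (2 * Real.pi)

theorem unitArg_mem (z : ℂ) : unitArg z ∈ Set.Ioc (-1 / 2 : ℝ) (1 / 2) := by
  have hp := Real.pi_pos
  have h1 := Complex.neg_pi_lt_arg z
  have h2 := Complex.arg_le_pi z
  unfold unitArg
  constructor
  · rw [lt_div_iff₀ (by positivity)]; linarith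
  · rw [div_le_iff₀ (by positivity)]; linarith

theorem exp_unitArg (z : ℂ) (hz : ‖z‖ = 1) :
    Complex.exp (2 * Real.pi * Complex.I * (unitArg z : ℂ)) = z := by
  have hp : (Real.pi : ℂ) ≠ 0 := by exact_mod_cast Real.pi_ne_zero
  have h := Complex.norm_mul_exp_arg_mul_I z
  rw [hz] at h
  have e : 2 * (Real.pi : ℂ) * Complex.I * (unitArg z : ℂ) = (Complex.arg z : ℂ) * Complex.I := by
    unfold unitArg
    push_cast
    field_simp
  rw [e]
  simpa using h

theorem dickmanStep_of_le_one (n : ℕ) {u : ℝ} (hu : u ≤ 1) : dickmanStep n u = 1 := by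
  cases n with
  | zero => rfl
  | succ n => simp [dickmanStep, max_eq_left hu]

theorem dickmanStep_continuous (n : ℕ) : Continuous (dickmanStep n) := by
  induction n with
  | zero => exact continuous_const
  | succ n ih =>
    -- on the range of integration `t = max 1 t`, and the new integrand is continuous
    have hc : Continuous fun t : ℝ => dickmanStep n (t - 1) / max 1 t := by
      refine Continuous.div (by fun_prop) (by fun_prop) fun t => ?_
      have : (1 : ℝ) ≤ max 1 t := le_max_left _ _
      linarith
    have he : dickmanStep (n + 1) =
        fun u => 1 - ∫ t in (1 : ℝ)..max 1 u, dickmanStep n (t - 1) / max 1 t := by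
      funext u
      simp only [dickmanStep]
      congr 1
      refine intervalIntegral.integral_congr fun t ht => ?_
      rw [Set.uIcc_of_le (le_max_left _ _)] at ht
      simp only [max_eq_right ht.1]
    rw [he]
    have h1 := intervalIntegral.continuous_primitive
      (fun a b => hc.intervalIntegrable (μ := MeasureTheory.volume) a b) 1
    exact continuous_const.sub (h1.comp (by fun_prop : Continuous fun u : ℝ => max 1 u))

theorem dickmanStep_succ_eq (n : ℕ) {u : ℝ} (hu : u ≤ n + 1) :
    dickmanStep (n + 1) u = dickmanStep n u := by
  induction n generalizing u with
  | zero =>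
    rw [dickmanStep_of_le_one 1 (by simpa using hu), dickmanStep_of_le_one 0 (by simpa using hu)]
  | succ n ih =>
    change 1 - (∫ t in (1 : ℝ)..max 1 u, dickmanStep (n + 1) (t - 1) / t) =
      1 - ∫ t in (1 : ℝ)..max 1 u, dickmanStep n (t - 1) / t
    congr 1
    refine intervalIntegral.integral_congr fun t ht => ?_
    rw [Set.uIcc_of_le (le_max_left _ _)] at ht
    have hn : (0 : ℝ) ≤ n := Nat.cast_nonneg n
    have h2 : t ≤ n + 2 := ht.2.trans (max_le (by linarith) (by push_cast at hu; linarith))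
    simp only [ih (u := t - 1) (by linarith)]

theorem dickmanRho_eq_step (n : ℕ) {u : ℝ} (hu : u ≤ n + 1) :
    dickmanRho u = dickmanStep n u := by
  have key : ∀ m k : ℕ, u ≤ m + 1 → dickmanStep (m + k) u = dickmanStep m u := by
    intro m k hm
    induction k with
    | zero => rfl
    | succ k ih =>
      rw [← ih, ← add_assoc]
      apply dickmanStep_succ_eq
      push_cast
      have : (0 : ℝ) ≤ k := Nat.cast_nonneg k
      linarith
  have hc : u ≤ (⌈u⌉₊ : ℝ) + 1 := (Nat.le_ceil u).trans (by linarith)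
  unfold dickmanRho
  rw [← key _ n hc, ← key n ⌈u⌉₊ hu, add_comm]

theorem dickmanRho_continuous : Continuous dickmanRho := by
  rw [continuous_iff_continuousAt]
  intro u
  refine (dickmanStep_continuous ⌈u⌉₊).continuousAt.congr ?_
  filter_upwards [Iio_mem_nhds (show u < (⌈u⌉₊ : ℝ) + 1 by linarith [Nat.le_ceil u])] with v hv
  exact (dickmanRho_eq_step _ (le_of_lt hv)).symm

/-- The integrated form of the delay differential equation. -/
theorem dickmanRho_integral {u : ℝ} (hu : 1 ≤ u) :
    dickmanRho u = 1 - ∫ t in (1 : ℝ)..u, dickmanRho (t - 1) / t := by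
  have hc : u ≤ (⌈u⌉₊ : ℝ) := Nat.le_ceil u
  rw [dickmanRho_eq_step (⌈u⌉₊ + 1) (by push_cast; linarith)]
  simp only [dickmanStep, max_eq_right hu]
  congr 1
  refine intervalIntegral.integral_congr fun t ht => ?_
  rw [Set.uIcc_of_le hu] at ht
  simp only [dickmanRho_eq_step ⌈u⌉₊ (u := t - 1) (by linarith [ht.2])]

theorem dickmanRho_spec :
    ContinuousOn dickmanRho (Set.Ici 0) ∧ (∀ u ∈ Set.Icc (0 : ℝ) 1, dickmanRho u = 1) ∧
      ∀ u : ℝ, 1 < u → DifferentiableAt ℝ dickmanRho u ∧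
        u * deriv dickmanRho u + dickmanRho (u - 1) = 0 := by
  refine ⟨dickmanRho_continuous.continuousOn, fun u hu => ?_, fun u hu => ?_⟩
  · rw [dickmanRho_eq_step 0 (by simpa using hu.2)]; rfl
  · have hu0 : u ≠ 0 := by linarith
    have hcont : ContinuousOn (fun t : ℝ => dickmanRho (t - 1) / t) (Set.Ioi 0) :=
      ContinuousOn.div (dickmanRho_continuous.comp (by fun_prop)).continuousOn (by fun_prop)
        fun t ht => ne_of_gt ht
    have hint : IntervalIntegrable (fun t : ℝ => dickmanRho (t - 1) / t)
        MeasureTheory.volume 1 u := by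
      refine (hcont.mono fun t ht => ?_).intervalIntegrable
      rw [Set.uIcc_of_le hu.le] at ht
      exact lt_of_lt_of_le one_pos ht.1
    have hd : HasDerivAt (fun v => 1 - ∫ t in (1 : ℝ)..v, dickmanRho (t - 1) / t)
        (-(dickmanRho (u - 1) / u)) u := by
      have hmem : Set.Ioi (0 : ℝ) ∈ nhds u := Ioi_mem_nhds (by linarith)
      exact (intervalIntegral.integral_hasDerivAt_right hint
        (hcont.stronglyMeasurableAtFilter isOpen_Ioi u (show (0 : ℝ) < u by linarith))
        (hcont.continuousAt hmem)).const_sub 1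
    have hd' : HasDerivAt dickmanRho (-(dickmanRho (u - 1) / u)) u := by
      refine hd.congr_of_eventuallyEq ?_
      filter_upwards [Ioi_mem_nhds hu] with v hv
      exact dickmanRho_integral (le_of_lt hv)
    refine ⟨hd'.differentiableAt, ?_⟩
    rw [hd'.deriv]
    field_simp
    ring

theorem dickmanRho_unique (f : ℝ → ℝ) (hf : ContinuousOn f (Set.Ici 0))
    (h1 : ∀ u ∈ Set.Icc (0 : ℝ) 1, f u = 1)
    (h2 : ∀ u : ℝ, 1 < u → DifferentiableAt ℝ f u ∧ u * deriv f u + f (u - 1) = 0) :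
    Set.EqOn f dickmanRho (Set.Ici 0) := by
  obtain ⟨r0, r1, r2⟩ := dickmanRho_spec
  have key : ∀ n : ℕ, ∀ u ∈ Set.Icc (0 : ℝ) (n + 1), f u = dickmanRho u := by
    intro n
    induction n with
    | zero =>
      intro u hu
      have hu' : u ∈ Set.Icc (0 : ℝ) 1 := by simpa using hu
      rw [h1 u hu', r1 u hu']
    | succ n ih =>
      intro u hu
      rcases le_or_gt u 1 with hu1 | hu1
      · rw [h1 u ⟨hu.1, hu1⟩, r1 u ⟨hu.1, hu1⟩]
      have hsub : Set.Icc 1 u ⊆ Set.Ici (0 : ℝ) := fun t ht => le_trans zero_le_one ht.1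
      have hd : ∀ t ∈ Set.Ioo 1 u, HasDerivAt (fun v => f v - dickmanRho v) 0 t := by
        intro t ht
        obtain ⟨a1, a2⟩ := h2 t ht.1
        obtain ⟨b1, b2⟩ := r2 t ht.1
        have hnu : u ≤ (n : ℝ) + 2 := by have := hu.2; push_cast at this; linarith
        have e := ih (t - 1) ⟨by linarith [ht.1], by linarith [ht.2]⟩
        have ht0 : t ≠ 0 := by linarith [ht.1]
        have e2 : deriv f t = deriv dickmanRho t := by
          apply mul_left_cancel₀ ht0
          linarith
        have := a1.hasDerivAt.sub b1.hasDerivAt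
        rw [e2, sub_self] at this
        exact this
      obtain ⟨t, ht, e⟩ := exists_hasDerivAt_eq_slope (fun v => f v - dickmanRho v) (fun _ => 0)
        hu1 ((hf.mono hsub).sub (r0.mono hsub)) hd
      have hne : u - 1 ≠ 0 := by linarith
      have e1 : f 1 = dickmanRho 1 := by rw [h1 1 (by simp), r1 1 (by simp)]
      rw [eq_comm, div_eq_zero_iff] at e
      rcases e with e | e
      · linarith
      · exact absurd e hne
  intro u hu
  exact key ⌈u⌉₊ u ⟨hu, (Nat.le_ceil u).trans (by linarith)⟩

/-!
The number `u = 1/δ` satisfies `1/d < ρ(u)`, and `ρ(u)^c ≤ ρ(u)`, so it suffices to find an integer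
`n ≤ y = q^{1/u}` with `|arg χ(n)| ≥ ρ(u)`. Suppose there is none. Then all values `χ(n)`, `n ≤ y`,
lie among the `2J + 1` powers `e^{2πij/d}` with `|j| ≤ J`, where `J < d ρ(u)`. This is refuted by
counting the integers up to `x = √q (log q)^5` in two ways.

* Equidistribution. The values `χ(n)`, `n ≤ x`, are equidistributed among the `d`-th roots of
  unity: orthogonality on `ℤ/d` and the Pólya--Vinogradov inequality for the powers of `χ` bound the
  number of `n ≤ x` with `χ(n)` in an arc of `2M + 1` roots of unity by
  `(2M + 1)/d · x + √q (1 + log q)^2` (`card_inArc_le`), and the growth condition on `g` makes the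
  error negligible against `ρ(u) x`.
* Smooth numbers. Write `x = y^{w/2}`, so that `w` exceeds `u` very slightly. By multiplicativity,
  an integer `n ≤ x` all of whose prime factors are at most `y` has its value in a slightly longer
  arc: such an `n` is a product of fewer than `w` factors that are at most `y`
  (`exists_inArc_of_isSmooth`). The density of these integers is about `ρ(w/2)`, which is much
  larger than `ρ(u)`.

When `w ≥ 3`, the density `ρ(w/2)` is replaced by the weaker bound `0.9 · 2^w ρ(w)`, which has an
inductive proof from Mertens' estimates (`smoothMinorant_mul_le_smoothCount`), and
`2 ⌈w⌉ - 1 ≤ (7/8) · 2^w` leaves enough room. When `w < 3`, an integer up to `x` has at most one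
prime factor above `y`, and the density is at least `1 - log (w/2)` up to a small error. For
`u ≥ 2.45` two factors suffice and `(4J + 1)/d < 5 ρ(u) < 1 - log (w/2)`. For `u < 2.45` that is not
enough; instead, values at `b ≤ √y` satisfy the stronger `|j| ≤ J/2`, since `χ(b)^2 = χ(b^2)`, and
outside the sparse set of `n` divisible by two primes above `√y` one can write `n = ab` with
`a ≤ y`, `b ≤ √y`. This gives the arc of `J + ⌊J/2⌋` steps, a contradiction unless `d = 7`, `J = 2`
(`arc_density_lt`). In the remaining case `χ(p) = 1` for all primes `p ≤ y^{1/3}`, because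
`e^{2πij/7}` and its square and cube all lie in the arc of `2` steps only for `j = 0`. Hence more
than `72%` of the `n ≤ x` have their value in the original arc (`inArc_seven_two`), whereas
equidistribution allows only about `5/7` of them.
-/

/-! ### The Dickman--de Bruijn function -/

theorem dickmanRho_of_le_one {u : ℝ} (hu : u ≤ 1) : dickmanRho u = 1 := by
  rw [dickmanRho_eq_step 0 (by simpa using hu)]; rfl

theorem hasDerivAt_dickmanRho {u : ℝ} (hu : 1 < u) :
    HasDerivAt dickmanRho (-(dickmanRho (u - 1) / u)) u := by
  obtain ⟨h1, h2⟩ := dickmanRho_spec.2.2 u hu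
  have : deriv dickmanRho u = -(dickmanRho (u - 1) / u) := by
    have hu0 : u ≠ 0 := by linarith
    field_simp
    linarith
  rw [← this]
  exact h1.hasDerivAt

theorem dickmanRho_intervalIntegrable (a b : ℝ) :
    IntervalIntegrable dickmanRho MeasureTheory.volume a b :=
  dickmanRho_continuous.intervalIntegrable a b

/-- The delay equation integrated over a window of length one. -/
theorem mul_dickmanRho_eq_integral {u : ℝ} (hu : 1 ≤ u) :
    u * dickmanRho u = ∫ t in (u - 1)..u, dickmanRho t := by
  set P : ℝ → ℝ := fun v => ∫ t in (0 : ℝ)..v, dickmanRho t with hP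
  have hPd : ∀ v, HasDerivAt P (dickmanRho v) v := fun v =>
    intervalIntegral.integral_hasDerivAt_right (dickmanRho_intervalIntegrable 0 v)
      (dickmanRho_continuous.stronglyMeasurableAtFilter _ _) dickmanRho_continuous.continuousAt
  have hsplit : ∀ v, (∫ t in (v - 1)..v, dickmanRho t) = P v - P (v - 1) := fun v =>
    (intervalIntegral.integral_interval_sub_left (dickmanRho_intervalIntegrable 0 v)
      (dickmanRho_intervalIntegrable 0 (v - 1))).symm
  rw [hsplit]
  have h1 : (1 : ℝ) * dickmanRho 1 = P 1 - P (1 - 1) := by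
    rw [← hsplit, dickmanRho_of_le_one le_rfl]
    have : ∫ t in (1 - 1 : ℝ)..1, dickmanRho t = ∫ t in (1 - 1 : ℝ)..1, (1 : ℝ) := by
      refine intervalIntegral.integral_congr fun t ht => ?_
      rw [Set.uIcc_of_le (by norm_num)] at ht
      exact dickmanRho_of_le_one ht.2
    rw [this]; simp
  rcases hu.eq_or_lt with rfl | hu1
  · exact h1
  have hPc : Continuous P := continuous_iff_continuousAt.2 fun v => (hPd v).continuousAt
  obtain ⟨c, hc, e⟩ := exists_hasDerivAt_eq_slope
    (fun v => v * dickmanRho v - (P v - P (v - 1))) (fun _ => 0) hu1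
    ((continuous_id.mul dickmanRho_continuous).sub
      (hPc.sub (hPc.comp (by fun_prop : Continuous fun v : ℝ => v - 1)))).continuousOn
    (fun v hv => by
      have hv0 : v ≠ 0 := by linarith [hv.1]
      have a1 := (hasDerivAt_id v).mul (hasDerivAt_dickmanRho hv.1)
      have a2 := (hPd v).sub ((hPd (v - 1)).comp_sub_const v 1)
      refine (a1.sub a2).congr_deriv ?_
      simp only [id]
      field_simp
      ring)
  have hne : u - 1 ≠ 0 := by linarith
  rw [eq_comm, div_eq_zero_iff] at e
  rcases e with e | e
  · linarith
  · exact absurd e hne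

theorem dickmanRho_pos (u : ℝ) : 0 < dickmanRho u := by
  by_contra hneg
  push Not at hneg
  set S : Set ℝ := {t | dickmanRho t ≤ 0} with hS
  have hSc : IsClosed S := isClosed_le dickmanRho_continuous continuous_const
  have hSb : ∀ t ∈ S, 1 < t := by
    intro t ht
    by_contra h
    have h1 := dickmanRho_of_le_one (not_lt.1 h)
    have h2 : dickmanRho t ≤ 0 := ht
    linarith
  have hSbdd : BddBelow S := ⟨1, fun t ht => (hSb t ht).le⟩
  have hmem : sInf S ∈ S := hSc.csInf_mem ⟨u, hneg⟩ hSbdd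
  have h1 := hSb _ hmem
  have hpos : 0 < ∫ t in (sInf S - 1)..(sInf S), dickmanRho t := by
    refine intervalIntegral.intervalIntegral_pos_of_pos_on (dickmanRho_intervalIntegrable _ _)
      (fun t ht => ?_) (by linarith)
    by_contra h
    exact absurd (csInf_le hSbdd (show t ∈ S from not_lt.1 h)) (not_le.2 ht.2)
  rw [← mul_dickmanRho_eq_integral h1.le] at hpos
  have h2 : dickmanRho (sInf S) ≤ 0 := hmem
  nlinarith

theorem dickmanRho_antitone : Antitone dickmanRho := by
  have h1 : AntitoneOn dickmanRho (Set.Iic 1) := fun a ha b hb _ => by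
    rw [dickmanRho_of_le_one ha, dickmanRho_of_le_one hb]
  have h2 : AntitoneOn dickmanRho (Set.Ici 1) := by
    refine antitoneOn_of_deriv_nonpos (convex_Ici 1) dickmanRho_continuous.continuousOn ?_ ?_
    · intro t ht
      rw [interior_Ici] at ht
      exact (hasDerivAt_dickmanRho ht).differentiableAt.differentiableWithinAt
    · intro t ht
      rw [interior_Ici] at ht
      rw [(hasDerivAt_dickmanRho ht).deriv]
      have := dickmanRho_pos (t - 1)
      have ht' : (0 : ℝ) < t := lt_trans one_pos ht
      have := div_pos this ht'
      linarith
  exact h1.Iic_union_Ici h2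

theorem dickmanRho_le_one (u : ℝ) : dickmanRho u ≤ 1 := by
  rcases le_total u 1 with h | h
  · rw [dickmanRho_of_le_one h]
  · rw [← dickmanRho_of_le_one (le_refl 1)]; exact dickmanRho_antitone h

theorem dickmanRho_eq_one_sub_log {u : ℝ} (h1 : 1 ≤ u) (h2 : u ≤ 2) :
    dickmanRho u = 1 - Real.log u := by
  rw [dickmanRho_integral h1]
  have : ∫ t in (1 : ℝ)..u, dickmanRho (t - 1) / t = ∫ t in (1 : ℝ)..u, 1 / t := by
    refine intervalIntegral.integral_congr fun t ht => ?_
    rw [Set.uIcc_of_le h1] at ht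
    simp only [dickmanRho_of_le_one (show t - 1 ≤ 1 by linarith [ht.2])]
  rw [this, integral_one_div_of_pos one_pos (by linarith), div_one]

/-- An upper bound obtained from `log (t - 1) ≤ t - 2`, accurate near `u = 2`. -/
theorem dickmanRho_le_of_mem_Icc_two_three {u : ℝ} (h1 : 2 ≤ u) (h2 : u ≤ 3) :
    dickmanRho u ≤ u - 1 + 2 * Real.log 2 - 3 * Real.log u := by
  have hm : MonotoneOn (fun t => t - 1 + 2 * Real.log 2 - 3 * Real.log t - dickmanRho t)
      (Set.Icc 2 3) := by
    have hd : ∀ t ∈ Set.Ioo (2 : ℝ) 3,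
        HasDerivAt (fun t => t - 1 + 2 * Real.log 2 - 3 * Real.log t - dickmanRho t)
          (1 - 3 * t⁻¹ - -(dickmanRho (t - 1) / t)) t := by
      intro t ht
      exact ((((hasDerivAt_id t).sub_const 1).add_const _).sub
        ((Real.hasDerivAt_log (by linarith [ht.1])).const_mul 3)).sub
        (hasDerivAt_dickmanRho (by linarith [ht.1]))
    refine monotoneOn_of_deriv_nonneg (convex_Icc 2 3) ?_ ?_ ?_
    · refine ContinuousOn.sub (ContinuousOn.sub (by fun_prop)
        (ContinuousOn.mul continuousOn_const (Real.continuousOn_log.mono ?_)))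
        dickmanRho_continuous.continuousOn
      intro t ht
      have := ht.1
      simp only [Set.mem_compl_iff, Set.mem_singleton_iff]
      linarith
    · intro t ht
      rw [interior_Icc] at ht
      exact (hd t ht).differentiableAt.differentiableWithinAt
    · intro t ht
      rw [interior_Icc] at ht
      rw [(hd t ht).deriv, dickmanRho_eq_one_sub_log (by linarith [ht.1]) (by linarith [ht.2])]
      have ht0 : 0 < t := by linarith [ht.1]
      have hl := Real.log_le_sub_one_of_pos (show 0 < t - 1 by linarith [ht.1])
      have e : 1 - 3 * t⁻¹ - -((1 - Real.log (t - 1)) / t) = (t - 2 - Real.log (t - 1)) / t := by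
        field_simp; ring
      rw [e]
      exact div_nonneg (by linarith) ht0.le
  have h := hm (show (2 : ℝ) ∈ Set.Icc (2 : ℝ) 3 by norm_num) ⟨h1, h2⟩ h1
  simp only [dickmanRho_eq_one_sub_log one_le_two (le_refl 2)] at h
  linarith

theorem dickmanRho_convexOn : ConvexOn ℝ (Set.Ici 1) dickmanRho := by
  refine MonotoneOn.convexOn_of_deriv (convex_Ici 1) dickmanRho_continuous.continuousOn ?_ ?_
  · intro t ht
    rw [interior_Ici] at ht
    exact (hasDerivAt_dickmanRho ht).differentiableAt.differentiableWithinAt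
  · intro a ha b hb hab
    rw [interior_Ici] at ha hb
    rw [(hasDerivAt_dickmanRho ha).deriv, (hasDerivAt_dickmanRho hb).deriv]
    have ha' : (0 : ℝ) < a := lt_trans one_pos ha
    exact neg_le_neg (div_le_div₀ (dickmanRho_pos _).le
      (dickmanRho_antitone (by linarith)) ha' hab)

/-- The trapezoidal rule overestimates the integral of a convex function; applied to the integrated
delay equation this gives geometric decay of `ρ` at twice the trivial rate. -/
theorem two_mul_sub_one_mul_dickmanRho_le {u : ℝ} (hu : 2 ≤ u) :
    (2 * u - 1) * dickmanRho u ≤ dickmanRho (u - 1) := by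
  have hint := mul_dickmanRho_eq_integral (show 1 ≤ u by linarith)
  have hle : ∫ t in (u - 1)..u, dickmanRho t ≤
      ∫ t in (u - 1)..u, ((u - t) * dickmanRho (u - 1) + (t - (u - 1)) * dickmanRho u) := by
    refine intervalIntegral.integral_mono_on (by linarith) (dickmanRho_intervalIntegrable _ _)
      (Continuous.intervalIntegrable (by fun_prop) _ _) fun t ht => ?_
    have := dickmanRho_convexOn.2 (show u - 1 ∈ Set.Ici (1 : ℝ) by simp; linarith)
      (show u ∈ Set.Ici (1 : ℝ) by simp; linarith) (show 0 ≤ u - t by linarith [ht.2])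
      (show 0 ≤ t - (u - 1) by linarith [ht.1]) (by ring)
    simp only [smul_eq_mul] at this
    have e : (u - t) * (u - 1) + (t - (u - 1)) * u = t := by ring
    rwa [e] at this
  have hval : ∫ t in (u - 1)..u, ((u - t) * dickmanRho (u - 1) + (t - (u - 1)) * dickmanRho u) =
      (dickmanRho (u - 1) + dickmanRho u) / 2 := by
    rw [intervalIntegral.integral_add (Continuous.intervalIntegrable (by fun_prop) _ _)
      (Continuous.intervalIntegrable (by fun_prop) _ _), intervalIntegral.integral_mul_const,
      intervalIntegral.integral_mul_const, intervalIntegral.integral_sub (by simp) (by simp),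
      intervalIntegral.integral_sub (by simp) (by simp)]
    simp only [intervalIntegral.integral_const, integral_id, smul_eq_mul]
    ring
  linarith

theorem dickmanRho_sub_half_le {u : ℝ} (hu : 1 ≤ u) :
    dickmanRho (u - 1 / 2) ≤ 2 * u * dickmanRho u := by
  have hint := mul_dickmanRho_eq_integral hu
  have h1 : ∫ t in (u - 1)..(u - 1 / 2), dickmanRho (u - 1 / 2) ≤
      ∫ t in (u - 1)..(u - 1 / 2), dickmanRho t :=
    intervalIntegral.integral_mono_on (by linarith) (by simp) (dickmanRho_intervalIntegrable _ _)
      fun t ht => dickmanRho_antitone ht.2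
  have h2 : 0 ≤ ∫ t in (u - 1 / 2)..u, dickmanRho t :=
    intervalIntegral.integral_nonneg (by linarith) fun t _ => (dickmanRho_pos t).le
  have h3 := intervalIntegral.integral_add_adjacent_intervals
    (dickmanRho_intervalIntegrable (u - 1) (u - 1 / 2))
    (dickmanRho_intervalIntegrable (u - 1 / 2) u)
  simp only [intervalIntegral.integral_const, smul_eq_mul] at h1
  linarith

/-- `ρ` varies slowly on the scale `1 / u`. -/
theorem mul_dickmanRho_le_of_le {u w : ℝ} (hu : 2 ≤ u) (huw : u ≤ w) :
    (1 - 4 * u * (w - u)) * dickmanRho u ≤ dickmanRho w := by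
  rcases huw.eq_or_lt with rfl | hlt
  · simp
  obtain ⟨c, hc, e⟩ := exists_hasDerivAt_eq_slope dickmanRho
    (fun t => -(dickmanRho (t - 1) / t)) hlt dickmanRho_continuous.continuousOn
    (fun t ht => hasDerivAt_dickmanRho (by linarith [ht.1]))
  have hwu : 0 < w - u := by linarith
  rw [eq_div_iff hwu.ne'] at e
  have h1 : dickmanRho (c - 1) / c ≤ dickmanRho (u - 1) / u :=
    div_le_div₀ (dickmanRho_pos _).le (dickmanRho_antitone (by linarith [hc.1])) (by linarith)
      hc.1.le
  have h2 := dickmanRho_sub_half_le (u := u) (by linarith)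
  have h3 := dickmanRho_sub_half_le (u := u - 1 / 2) (by linarith)
  have e3 : u - 1 / 2 - 1 / 2 = u - 1 := by ring
  rw [e3] at h3
  have hp := dickmanRho_pos u
  have hp2 := dickmanRho_pos (u - 1 / 2)
  have h4 : dickmanRho (u - 1) / u ≤ 4 * u * dickmanRho u := by
    rw [div_le_iff₀ (by linarith)]
    calc dickmanRho (u - 1) ≤ 2 * u * dickmanRho (u - 1 / 2) := by
          refine h3.trans ?_
          gcongr
          linarith
      _ ≤ 2 * u * (2 * u * dickmanRho u) := by gcongr
      _ = 4 * u * dickmanRho u * u := by ring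
  have h5 := mul_le_mul_of_nonneg_right (h1.trans h4) hwu.le
  linarith

/-- A crude lower bound of size `(2u)^{-2u}`, from `2u` steps of length `1/2`. -/
theorem exp_neg_le_dickmanRho {u : ℝ} (hu : 1 ≤ u) :
    Real.exp (-(2 * u * Real.log (2 * u))) ≤ dickmanRho u := by
  have hU : 0 < 2 * u := by linarith
  have key : ∀ n : ℕ, ∀ t : ℝ, t ≤ u → t ≤ 1 + n / 2 → 1 ≤ (2 * u) ^ n * dickmanRho t := by
    intro n
    induction n with
    | zero =>
      intro t _ ht
      rw [dickmanRho_of_le_one (by simpa using ht)]; simp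
    | succ n ih =>
      intro t htu ht
      rcases le_total t 1 with h | h
      · rw [dickmanRho_of_le_one h, mul_one]
        exact one_le_pow₀ (by linarith)
      · have h1 := ih (t - 1 / 2) (by linarith) (by push_cast at ht; linarith)
        refine h1.trans ?_
        rw [pow_succ, mul_assoc]
        gcongr
        refine (dickmanRho_sub_half_le h).trans ?_
        have := dickmanRho_pos t
        gcongr
  set n := ⌈2 * (u - 1)⌉₊ with hn
  have h1 := key n u le_rfl (by have := Nat.le_ceil (2 * (u - 1)); linarith)
  have h2 : (n : ℝ) ≤ 2 * u := by
    have := Nat.ceil_lt_add_one (show 0 ≤ 2 * (u - 1) by linarith)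
    linarith
  have h3 : (2 * u) ^ n ≤ Real.exp (2 * u * Real.log (2 * u)) := by
    rw [← Real.rpow_natCast, Real.rpow_def_of_pos hU, Real.exp_le_exp, mul_comm]
    gcongr
    exact Real.log_nonneg (by linarith)
  rw [Real.exp_neg, inv_le_iff_one_le_mul₀ (Real.exp_pos _), mul_comm]
  exact h1.trans (mul_le_mul_of_nonneg_right h3 (dickmanRho_pos u).le)

theorem antitoneOn_two_rpow_mul_dickmanRho :
    AntitoneOn (fun w : ℝ => (2 : ℝ) ^ w * dickmanRho w) (Set.Ici 2) := by
  have hd : ∀ w : ℝ, 2 < w → HasDerivAt (fun w : ℝ => (2 : ℝ) ^ w * dickmanRho w)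
      ((2 : ℝ) ^ w * Real.log 2 * dickmanRho w + 2 ^ w * (-(dickmanRho (w - 1) / w))) w := by
    intro w hw
    have h1 := (hasDerivAt_id w).const_rpow (a := 2) (by norm_num)
    have h2 := h1.mul (hasDerivAt_dickmanRho (show 1 < w by linarith))
    refine h2.congr_deriv ?_
    simp only [id]
    ring
  refine antitoneOn_of_deriv_nonpos (convex_Ici 2) ?_ ?_ ?_
  · exact (Continuous.mul (Real.continuous_const_rpow (by norm_num))
      dickmanRho_continuous).continuousOn
  · intro w hw
    rw [interior_Ici] at hw
    exact (hd w hw).differentiableAt.differentiableWithinAt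
  · intro w hw
    rw [interior_Ici] at hw
    have hw' : 2 < w := hw
    rw [(hd w hw).deriv]
    have h1 := two_mul_sub_one_mul_dickmanRho_le hw'.le
    have hp := dickmanRho_pos w
    have h2 : dickmanRho w ≤ dickmanRho (w - 1) / w := by
      rw [le_div_iff₀ (by linarith)]; nlinarith
    have h3 : Real.log 2 ≤ 1 := by linarith [Real.log_two_lt_d9]
    have h4 : (0 : ℝ) < 2 ^ w := by positivity
    have h5 : Real.log 2 * dickmanRho w ≤ dickmanRho (w - 1) / w := by nlinarith
    have := mul_le_mul_of_nonneg_left h5 h4.le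
    linarith

/-! ### Mertens' estimates -/

open ArithmeticFunction in
/-- The partial sums `∑_{k ≤ t} Λ(k) / k`. -/
noncomputable def mangoldtSum (t : ℝ) : ℝ := ∑ k ∈ Finset.Icc 0 ⌊t⌋₊, vonMangoldt k / (k : ℝ)

open ArithmeticFunction in
theorem mangoldtSum_eq_sum_Ioc (t : ℝ) :
    mangoldtSum t = ∑ k ∈ Finset.Ioc 0 ⌊t⌋₊, vonMangoldt k / (k : ℝ) := by
  unfold mangoldtSum
  rw [← Finset.sum_Ioc_add_eq_sum_Icc (Nat.zero_le _)]
  simp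

open ArithmeticFunction in
theorem log_factorial_eq_sum_mangoldt (N : ℕ) :
    Real.log (N.factorial : ℝ) = ∑ k ∈ Finset.Ioc 0 N, vonMangoldt k * ((N / k : ℕ) : ℝ) := by
  have h1 := sum_Ioc_mul_zeta_eq_sum vonMangoldt N
  rw [← h1, vonMangoldt_mul_zeta]
  have : (N.factorial : ℝ) = ∏ k ∈ Finset.Ioc 0 N, (k : ℝ) := by
    rw [← Finset.prod_Ico_id_eq_factorial]
    push_cast
    rfl
  rw [this, Real.log_prod (fun k hk => by have := (Finset.mem_Ioc.1 hk).1; positivity)]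
  simp [log_apply]

open ArithmeticFunction in
/-- The lower half of Mertens' first estimate, by comparison of `∑ Λ(k) ⌊N / k⌋ = log N!` with
`∑ Λ(k) N / k`. -/
theorem log_sub_two_le_mangoldtSum {t : ℝ} (ht : 1 ≤ t) : Real.log t - 2 ≤ mangoldtSum t := by
  set N := ⌊t⌋₊ with hN
  have hN1 : 1 ≤ N := Nat.one_le_floor_iff _ |>.2 ht
  have hNpos : (0 : ℝ) < N := by exact_mod_cast hN1
  have hst := Stirling.le_log_factorial_stirling (show N ≠ 0 by omega)
  have hlN : 0 ≤ Real.log N := Real.log_nonneg (by exact_mod_cast hN1)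
  have hl2 : 0 ≤ Real.log (2 * Real.pi) := Real.log_nonneg (by linarith [Real.pi_gt_three])
  rw [log_factorial_eq_sum_mangoldt] at hst
  have hle : ∑ k ∈ Finset.Ioc 0 N, vonMangoldt k * ((N / k : ℕ) : ℝ) ≤ N * mangoldtSum t := by
    rw [mangoldtSum_eq_sum_Ioc, Finset.mul_sum]
    refine Finset.sum_le_sum fun k hk => ?_
    have : ((N / k : ℕ) : ℝ) ≤ N / k := Nat.cast_div_le
    calc vonMangoldt k * ((N / k : ℕ) : ℝ) ≤ vonMangoldt k * (N / k) :=
          mul_le_mul_of_nonneg_left this vonMangoldt_nonneg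
      _ = _ := by ring
  have h1 : Real.log N - 1 ≤ mangoldtSum t := by
    have : (N : ℝ) * (Real.log N - 1) ≤ N * mangoldtSum t := by linarith
    exact le_of_mul_le_mul_left this hNpos
  have h2 : Real.log t ≤ Real.log N + Real.log 2 := by
    rw [← Real.log_mul hNpos.ne' (by norm_num)]
    refine Real.log_le_log (by linarith) ?_
    have := Nat.lt_floor_add_one t
    have : (1 : ℝ) ≤ N := by exact_mod_cast hN1
    linarith
  linarith [Real.log_two_lt_d9]

open ArithmeticFunction in
/-- The upper half of Mertens' first estimate; the rounding errors are bounded by Chebyshev's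
function `ψ`. -/
theorem mangoldtSum_le_log_add_six {t : ℝ} (ht : 1 ≤ t) : mangoldtSum t ≤ Real.log t + 6 := by
  set N := ⌊t⌋₊ with hN
  have hN1 : 1 ≤ N := Nat.one_le_floor_iff _ |>.2 ht
  have hNpos : (0 : ℝ) < N := by exact_mod_cast hN1
  have hfac : Real.log (N.factorial : ℝ) ≤ N * Real.log N := by
    rw [← Real.log_pow]
    refine Real.log_le_log (by exact_mod_cast N.factorial_pos) ?_
    exact_mod_cast Nat.factorial_le_pow N
  rw [log_factorial_eq_sum_mangoldt] at hfac
  have hge : N * mangoldtSum t - Chebyshev.psi N ≤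
      ∑ k ∈ Finset.Ioc 0 N, vonMangoldt k * ((N / k : ℕ) : ℝ) := by
    rw [mangoldtSum_eq_sum_Ioc, Finset.mul_sum, Chebyshev.psi, Nat.floor_natCast,
      ← Finset.sum_sub_distrib]
    refine Finset.sum_le_sum fun k hk => ?_
    have hk0 := (Finset.mem_Ioc.1 hk).1
    have h1 : (N : ℝ) / k - 1 ≤ ((N / k : ℕ) : ℝ) := by
      rw [← Nat.floor_div_eq_div (K := ℝ)]
      linarith [Nat.lt_floor_add_one ((N : ℝ) / k)]
    calc (N : ℝ) * (vonMangoldt k / k) - vonMangoldt k = vonMangoldt k * (N / k - 1) := by ring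
      _ ≤ _ := mul_le_mul_of_nonneg_left h1 vonMangoldt_nonneg
  have hpsi := Chebyshev.psi_le_const_mul_self hNpos.le
  have hl4 : Real.log 4 ≤ 2 := by
    rw [show (4 : ℝ) = 2 ^ 2 by norm_num, Real.log_pow]
    push_cast
    linarith [Real.log_two_lt_d9]
  have h1 : mangoldtSum t ≤ Real.log N + 6 := by
    have : (N : ℝ) * mangoldtSum t ≤ N * (Real.log N + 6) := by nlinarith
    exact le_of_mul_le_mul_left this hNpos
  have h2 : Real.log N ≤ Real.log t := Real.log_le_log hNpos (Nat.floor_le (by linarith))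
  linarith

/-- The sum of `1 / p` over the primes `p ∈ (A, B]`. -/
noncomputable def primeRecipSum (A B : ℝ) : ℝ :=
  ∑ p ∈ (Finset.Ioc ⌊A⌋₊ ⌊B⌋₊).filter Nat.Prime, 1 / (p : ℝ)

theorem primeRecipSum_nonneg (A B : ℝ) : 0 ≤ primeRecipSum A B :=
  Finset.sum_nonneg fun p _ => by positivity

open ArithmeticFunction in
/-- Mertens' second estimate, one-sided, by partial summation from the bounds for
`∑ Λ(k) / k`. -/
theorem primeRecipSum_le {A B : ℝ} (hA : 2 ≤ A) (hAB : A ≤ B) :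
    primeRecipSum A B ≤ Real.log (Real.log B / Real.log A) + 8 / Real.log A := by
  have hlog : ∀ t : ℝ, A ≤ t → 0 < Real.log t := fun t ht => Real.log_pos (by linarith)
  have hlA := hlog A le_rfl
  have hlB := hlog B hAB
  have hlAB : Real.log A ≤ Real.log B := Real.log_le_log (by linarith) hAB
  have hd : ∀ t ∈ Set.Icc A B, HasDerivAt (fun t : ℝ => (Real.log t)⁻¹)
      (-t⁻¹ / Real.log t ^ 2) t := fun t ht =>
    (Real.hasDerivAt_log (by linarith [ht.1])).inv (hlog t ht.1).ne'
  have hder : Set.EqOn (deriv fun t : ℝ => (Real.log t)⁻¹) (fun t => -t⁻¹ / Real.log t ^ 2)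
      (Set.Icc A B) := fun t ht => (hd t ht).deriv
  have hcont : ContinuousOn (fun t : ℝ => -t⁻¹ / Real.log t ^ 2) (Set.Icc A B) := by
    intro t ht
    have h1 : t ≠ 0 := by linarith [ht.1]
    have h2 := (hlog t ht.1).ne'
    exact ((continuousAt_id.inv₀ h1).neg.div ((Real.continuousAt_log h1).pow 2)
      (pow_ne_zero 2 h2)).continuousWithinAt
  have hint : MeasureTheory.IntegrableOn (deriv fun t : ℝ => (Real.log t)⁻¹) (Set.Icc A B) :=
    (hcont.integrableOn_Icc).congr_fun hder.symm measurableSet_Icc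
  have habel := sum_mul_eq_sub_sub_integral_mul (fun k : ℕ => vonMangoldt k / (k : ℝ))
    (by linarith : 0 ≤ A) hAB (fun t ht => (hd t ht).differentiableAt) hint
  have hintprod := integrableOn_mul_sum_Icc (m := 0) (fun k : ℕ => vonMangoldt k / (k : ℝ))
    (by linarith : 0 ≤ A) hint
  change _ = (Real.log B)⁻¹ * mangoldtSum B - (Real.log A)⁻¹ * mangoldtSum A -
    ∫ t in Set.Ioc A B, deriv (fun t : ℝ => (Real.log t)⁻¹) t * mangoldtSum t at habel
  change MeasureTheory.IntegrableOn
    (fun t => deriv (fun t : ℝ => (Real.log t)⁻¹) t * mangoldtSum t) _ at hintprod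
  -- `log log t - 6 / log t` is a primitive of the majorant of the integrand
  have hprim : ∀ t ∈ Set.Icc A B,
      HasDerivAt (fun t : ℝ => Real.log (Real.log t) - 6 * (Real.log t)⁻¹)
      (t⁻¹ / Real.log t ^ 2 * (Real.log t + 6)) t := by
    intro t ht
    have h1 : t ≠ 0 := by linarith [ht.1]
    have h2 := (hlog t ht.1).ne'
    refine (((Real.hasDerivAt_log h1).log h2).sub ((hd t ht).const_mul 6)).congr_deriv ?_
    field_simp
    ring
  have hcont2 : ContinuousOn (fun t : ℝ => t⁻¹ / Real.log t ^ 2 * (Real.log t + 6))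
      (Set.Icc A B) := by
    intro t ht
    have h1 : t ≠ 0 := by linarith [ht.1]
    have h2 := (hlog t ht.1).ne'
    exact (((continuousAt_id.inv₀ h1).div ((Real.continuousAt_log h1).pow 2)
      (pow_ne_zero 2 h2)).mul
      ((Real.continuousAt_log h1).add continuousAt_const)).continuousWithinAt
  have hftc : ∫ t in A..B, t⁻¹ / Real.log t ^ 2 * (Real.log t + 6) =
      (Real.log (Real.log B) - 6 * (Real.log B)⁻¹) -
        (Real.log (Real.log A) - 6 * (Real.log A)⁻¹) := by
    refine intervalIntegral.integral_eq_sub_of_hasDerivAt (fun t ht => hprim t ?_) ?_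
    · rwa [Set.uIcc_of_le hAB] at ht
    · exact ContinuousOn.intervalIntegrable (by rwa [Set.uIcc_of_le hAB])
  have hintle : -∫ t in Set.Ioc A B, deriv (fun t : ℝ => (Real.log t)⁻¹) t * mangoldtSum t ≤
      ∫ t in A..B, t⁻¹ / Real.log t ^ 2 * (Real.log t + 6) := by
    rw [intervalIntegral.integral_of_le hAB, ← MeasureTheory.integral_neg]
    refine MeasureTheory.setIntegral_mono_on
      (hintprod.mono_set Set.Ioc_subset_Icc_self).neg
      (hcont2.integrableOn_Icc.mono_set Set.Ioc_subset_Icc_self) measurableSet_Ioc fun t ht => ?_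
    have ht' := Set.Ioc_subset_Icc_self ht
    have h0 : 0 < t := by linarith [ht'.1]
    have h2 := hlog t ht'.1
    rw [hder ht']
    have h3 := mangoldtSum_le_log_add_six (show 1 ≤ t by linarith [ht'.1])
    have h4 : 0 ≤ t⁻¹ / Real.log t ^ 2 := by positivity
    have := mul_le_mul_of_nonneg_left h3 h4
    simp only [neg_div]
    linarith
  have hsum : primeRecipSum A B ≤ ∑ k ∈ Finset.Ioc ⌊A⌋₊ ⌊B⌋₊,
      (Real.log (k : ℝ))⁻¹ * (vonMangoldt k / (k : ℝ)) := by
    unfold primeRecipSum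
    rw [Finset.sum_filter]
    refine Finset.sum_le_sum fun k hk => ?_
    split_ifs with hp
    · rw [vonMangoldt_apply_prime hp]
      have : 0 < Real.log k := Real.log_pos (by exact_mod_cast hp.one_lt)
      have hk0 : (0 : ℝ) < k := by exact_mod_cast hp.pos
      apply le_of_eq
      field_simp
    · exact mul_nonneg (inv_nonneg.2 (Real.log_natCast_nonneg k))
        (div_nonneg vonMangoldt_nonneg (Nat.cast_nonneg k))
  have hB := mangoldtSum_le_log_add_six (show 1 ≤ B by linarith)
  have hA' := log_sub_two_le_mangoldtSum (show 1 ≤ A by linarith)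
  have e1 : (Real.log B)⁻¹ * mangoldtSum B ≤ 1 + 6 * (Real.log B)⁻¹ := by
    rw [inv_mul_le_iff₀ hlB]
    field_simp
    linarith
  have e2 : 1 - 2 * (Real.log A)⁻¹ ≤ (Real.log A)⁻¹ * mangoldtSum A := by
    rw [le_inv_mul_iff₀ hlA]
    field_simp
    linarith
  rw [Real.log_div hlB.ne' hlA.ne', div_eq_mul_inv]
  linarith

/-! ### Character values in arcs: the Pólya--Vinogradov inequality -/

/-- The root of unity `e^{2πij/d}`. -/
noncomputable def rootExp (d : ℕ) (j : ℤ) : ℂ := Complex.exp (2 * Real.pi * Complex.I * j / d)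

theorem rootExp_add (d : ℕ) (i j : ℤ) : rootExp d (i + j) = rootExp d i * rootExp d j := by
  unfold rootExp
  rw [← Complex.exp_add]
  congr 1
  push_cast
  ring

theorem rootExp_zero (d : ℕ) : rootExp d 0 = 1 := by simp [rootExp]

theorem rootExp_nat_mul (d k : ℕ) (j : ℤ) : rootExp d (k * j) = rootExp d j ^ k := by
  unfold rootExp
  rw [← Complex.exp_nat_mul]
  congr 1
  push_cast
  ring

theorem rootExp_eq_exp_mul_I (d : ℕ) (j : ℤ) :
    rootExp d j = Complex.exp (((2 * Real.pi * j / d : ℝ) : ℂ) * Complex.I) := by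
  unfold rootExp
  congr 1
  push_cast
  ring

theorem norm_rootExp (d : ℕ) (j : ℤ) : ‖rootExp d j‖ = 1 := by
  rw [rootExp_eq_exp_mul_I, Complex.norm_exp_ofReal_mul_I]

theorem rootExp_eq_one_iff {d : ℕ} (hd : d ≠ 0) (j : ℤ) : rootExp d j = 1 ↔ (d : ℤ) ∣ j := by
  have hd' : (d : ℂ) ≠ 0 := by exact_mod_cast hd
  have hpi : (2 * Real.pi * Complex.I : ℂ) ≠ 0 := Complex.two_pi_I_ne_zero
  unfold rootExp
  rw [Complex.exp_eq_one_iff]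
  constructor
  · rintro ⟨n, hn⟩
    refine ⟨n, ?_⟩
    have h2 : (2 * Real.pi * Complex.I : ℂ) * j = (2 * Real.pi * Complex.I) * (d * n) := by
      field_simp at hn
      linear_combination (2 * Real.pi * Complex.I) * hn
    exact_mod_cast mul_left_cancel₀ hpi h2
  · rintro ⟨n, rfl⟩
    refine ⟨n, ?_⟩
    push_cast
    field_simp

/-- The bound `1 / |sin (πl/N)|` for a geometric sum, with the sine estimated by its chord on each
half of the period. -/
theorem norm_geom_sum_rootExp_le {N l : ℕ} (hl : 1 ≤ l) (hlN : l < N) (K : ℕ) :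
    ‖∑ n ∈ Finset.range K, rootExp N l ^ n‖ ≤ N / 2 * (1 / (l : ℝ) + 1 / ((N - l : ℕ) : ℝ)) := by
  have hN0 : N ≠ 0 := by omega
  have hNpos : (0 : ℝ) < N := by exact_mod_cast Nat.pos_of_ne_zero hN0
  have hlpos : (0 : ℝ) < l := by exact_mod_cast hl
  have hmpos : (0 : ℝ) < ((N - l : ℕ) : ℝ) := by exact_mod_cast (show 0 < N - l by omega)
  have hmc : ((N - l : ℕ) : ℝ) = N - l := by push_cast [hlN.le]; ring
  have hne : rootExp N l ≠ 1 := by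
    rw [Ne, rootExp_eq_one_iff hN0]
    intro h
    have := Int.le_of_dvd (by omega) h
    omega
  rw [geom_sum_eq hne, norm_div]
  have hnum : ‖rootExp N l ^ K - 1‖ ≤ 2 := by
    refine (norm_sub_le _ _).trans ?_
    rw [norm_pow, norm_rootExp]; norm_num
  have hsin : 0 < Real.sin (Real.pi * l / N) ∧
      (Real.sin (Real.pi * l / N))⁻¹ ≤ N / 2 * (1 / (l : ℝ) + 1 / ((N - l : ℕ) : ℝ)) := by
    have hpi := Real.pi_pos
    rcases le_total (2 * l) N with h | h
    · have h' : (2 : ℝ) * l ≤ N := by exact_mod_cast h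
      have := Real.mul_le_sin (x := Real.pi * l / N) (by positivity)
        (by rw [div_le_div_iff₀ hNpos two_pos]; nlinarith)
      have e : 2 / Real.pi * (Real.pi * l / N) = 2 * l / N := by field_simp
      rw [e] at this
      have hp : (0 : ℝ) < 2 * l / N := by positivity
      refine ⟨hp.trans_le this, (inv_anti₀ hp this).trans ?_⟩
      have : (0 : ℝ) ≤ N / 2 * (1 / ((N - l : ℕ) : ℝ)) := by positivity
      rw [mul_add]
      have e2 : (2 * (l : ℝ) / N)⁻¹ = N / 2 * (1 / l) := by field_simp
      linarith
    · have h' : (N : ℝ) ≤ 2 * l := by exact_mod_cast h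
      have hsymm : Real.sin (Real.pi * l / N) = Real.sin (Real.pi * ((N - l : ℕ) : ℝ) / N) := by
        rw [← Real.sin_pi_sub, hmc]
        congr 1
        field_simp
      have := Real.mul_le_sin (x := Real.pi * ((N - l : ℕ) : ℝ) / N) (by positivity)
        (by rw [div_le_div_iff₀ hNpos two_pos, hmc]; nlinarith)
      have e : 2 / Real.pi * (Real.pi * ((N - l : ℕ) : ℝ) / N) = 2 * ((N - l : ℕ) : ℝ) / N := by
        field_simp
      rw [e, ← hsymm] at this
      have hp : (0 : ℝ) < 2 * ((N - l : ℕ) : ℝ) / N := by positivity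
      refine ⟨hp.trans_le this, (inv_anti₀ hp this).trans ?_⟩
      have : (0 : ℝ) ≤ N / 2 * (1 / (l : ℝ)) := by positivity
      rw [mul_add]
      have e2 : (2 * ((N - l : ℕ) : ℝ) / N)⁻¹ = N / 2 * (1 / ((N - l : ℕ) : ℝ)) := by field_simp
      linarith
  have hden : ‖rootExp N l - 1‖ = 2 * Real.sin (Real.pi * l / N) := by
    have e : rootExp N l = Complex.exp (Complex.I * ((2 * Real.pi * l / N : ℝ) : ℂ)) := by
      rw [rootExp_eq_exp_mul_I, mul_comm]; simp
    rw [e, Complex.norm_exp_I_mul_ofReal_sub_one]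
    have e2 : 2 * Real.pi * l / N / 2 = Real.pi * l / N := by ring
    rw [e2, Real.norm_eq_abs, abs_of_pos (by linarith [hsin.1])]
  rw [hden]
  refine le_trans ?_ hsin.2
  rw [div_le_iff₀ (by linarith [hsin.1])]
  have : (Real.sin (Real.pi * l / N))⁻¹ * (2 * Real.sin (Real.pi * l / N)) = 2 := by
    field_simp [hsin.1.ne']
  linarith

/-- The Fourier coefficients of an interval modulo `N` have `ℓ¹`-norm `O(N log N)`. -/
theorem sum_norm_geom_sum_rootExp_le {N : ℕ} (hN : 1 ≤ N) (K : ℕ) :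
    ∑ l ∈ Finset.Ico 1 N, ‖∑ n ∈ Finset.range K, rootExp N l ^ n‖ ≤ N * (1 + Real.log N) := by
  have hharm : ∑ l ∈ Finset.Ico 1 N, 1 / (l : ℝ) ≤ 1 + Real.log N := by
    refine le_trans ?_ (harmonic_le_one_add_log N)
    rw [harmonic_eq_sum_Icc]
    push_cast
    simp only [one_div]
    refine Finset.sum_le_sum_of_subset_of_nonneg (fun l hl => ?_) fun l _ _ => by positivity
    rw [Finset.mem_Ico] at hl
    rw [Finset.mem_Icc]
    omega
  have hrefl : ∑ l ∈ Finset.Ico 1 N, 1 / ((N - l : ℕ) : ℝ) = ∑ l ∈ Finset.Ico 1 N, 1 / (l : ℝ) :=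
    Finset.sum_nbij' (fun l => N - l) (fun l => N - l)
      (fun l hl => by rw [Finset.mem_Ico] at *; omega)
      (fun l hl => by rw [Finset.mem_Ico] at *; omega)
      (fun l hl => by rw [Finset.mem_Ico] at *; omega)
      (fun l hl => by rw [Finset.mem_Ico] at *; omega) (fun l _ => rfl)
  calc _ ≤ ∑ l ∈ Finset.Ico 1 N, (N : ℝ) / 2 * (1 / (l : ℝ) + 1 / ((N - l : ℕ) : ℝ)) := by
        refine Finset.sum_le_sum fun l hl => ?_
        rw [Finset.mem_Ico] at hl
        exact norm_geom_sum_rootExp_le hl.1 hl.2 K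
    _ = N / 2 * (∑ l ∈ Finset.Ico 1 N, 1 / (l : ℝ) + ∑ l ∈ Finset.Ico 1 N, 1 / (l : ℝ)) := by
        rw [← Finset.mul_sum, Finset.sum_add_distrib, hrefl]
    _ ≤ N / 2 * ((1 + Real.log N) + (1 + Real.log N)) := by gcongr
    _ = _ := by ring

theorem norm_gaussSum_stdAddChar {q : ℕ} [Fact q.Prime] {χ : DirichletCharacter ℂ q} (hχ : χ ≠ 1) :
    ‖gaussSum χ (ZMod.stdAddChar (N := q))‖ = Real.sqrt q := by
  have h := gaussSum_mul_gaussSum_eq_card hχ (ZMod.isPrimitive_stdAddChar q)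
  rw [← star_gaussSum_eq, ZMod.card] at h
  have h2 := congrArg norm h
  rw [norm_mul, norm_star, Complex.norm_natCast] at h2
  rw [← h2, Real.sqrt_mul_self (norm_nonneg _)]

theorem isPrimitive_of_ne_one {q : ℕ} (hq : q.Prime) {χ : DirichletCharacter ℂ q} (hχ : χ ≠ 1) :
    χ.IsPrimitive := by
  have : NeZero q := ⟨hq.ne_zero⟩
  rcases (Nat.dvd_prime hq).1 χ.conductor_dvd_level with h | h
  · exact absurd ((DirichletCharacter.eq_one_iff_conductor_eq_one).2 h) hχ
  · exact h

/-- The Pólya--Vinogradov inequality for prime modulus. -/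
theorem norm_sum_dirichletCharacter_le {q : ℕ} (hq : q.Prime) {χ : DirichletCharacter ℂ q}
    (hχ : χ ≠ 1) (X : ℕ) :
    ‖∑ n ∈ Finset.Icc 1 X, χ (n : ZMod q)‖ ≤ Real.sqrt q * (1 + Real.log q) := by
  have : Fact q.Prime := ⟨hq⟩
  have : NeZero q := ⟨hq.ne_zero⟩
  have hqpos : (0 : ℝ) < q := by exact_mod_cast hq.pos
  set ψ := ZMod.stdAddChar (N := q) with hψ
  have hχ' : χ⁻¹ ≠ 1 := by simpa using hχ
  set τ := gaussSum χ⁻¹ ψ with hτ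
  have hτn : ‖τ‖ = Real.sqrt q := norm_gaussSum_stdAddChar hχ'
  have hprod : (∑ n ∈ Finset.Icc 1 X, χ (n : ZMod q)) * τ =
      ∑ a : ZMod q, χ⁻¹ a * ∑ n ∈ Finset.Icc 1 X, ψ (n * a) := by
    simp_rw [Finset.mul_sum]
    rw [Finset.sum_comm, Finset.sum_mul]
    refine Finset.sum_congr rfl fun n _ => ?_
    have := gaussSum_mulShift_of_isPrimitive ψ (isPrimitive_of_ne_one hq hχ') (n : ZMod q)
    rw [inv_inv] at this
    rw [← this]
    rfl
  have hval : ∀ l : ℕ, ‖∑ n ∈ Finset.Icc 1 X, ψ (n * (l : ZMod q))‖ =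
      ‖∑ n ∈ Finset.range X, rootExp q l ^ n‖ := by
    intro l
    have h1 : ∀ n : ℕ, ψ (n * (l : ZMod q)) = rootExp q l ^ n := by
      intro n
      rw [← nsmul_eq_mul, AddChar.map_nsmul_eq_pow]
      have := ZMod.stdAddChar_coe (N := q) (l : ℤ)
      rw [Int.cast_natCast] at this
      rw [hψ, this]
      rfl
    simp_rw [h1]
    have h2 : ∑ n ∈ Finset.Icc 1 X, rootExp q l ^ n =
        rootExp q l * ∑ n ∈ Finset.range X, rootExp q l ^ n := by
      rw [Finset.mul_sum, ← Finset.Ico_add_one_right_eq_Icc, Finset.sum_Ico_eq_sum_range]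
      refine Finset.sum_congr (by simp) fun n _ => ?_
      rw [pow_add, pow_one]
    rw [h2, norm_mul, norm_rootExp, one_mul]
  have hbound : ‖∑ a : ZMod q, χ⁻¹ a * ∑ n ∈ Finset.Icc 1 X, ψ (n * a)‖ ≤
      q * (1 + Real.log q) := by
    have e : ∑ a : ZMod q, χ⁻¹ a * ∑ n ∈ Finset.Icc 1 X, ψ (n * a) =
        ∑ l ∈ Finset.range q, χ⁻¹ (l : ZMod q) * ∑ n ∈ Finset.Icc 1 X, ψ (n * (l : ZMod q)) := by
      refine Finset.sum_nbij' (fun a => a.val) (fun l => (l : ZMod q)) ?_ ?_ ?_ ?_ ?_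
      · intro a _; exact Finset.mem_range.2 (ZMod.val_lt a)
      · intro l _; exact Finset.mem_univ _
      · intro a _; exact ZMod.natCast_zmod_val a
      · intro l hl; exact ZMod.val_cast_of_lt (Finset.mem_range.1 hl)
      · intro a _; simp only [ZMod.natCast_zmod_val]
    rw [e, Finset.range_eq_Ico, Finset.sum_eq_sum_Ico_succ_bot hq.pos]
    have h0 : χ⁻¹ ((0 : ℕ) : ZMod q) = 0 := by
      rw [Nat.cast_zero]
      exact MulChar.map_zero _
    rw [h0, zero_mul, zero_add]
    refine (norm_sum_le _ _).trans (le_trans ?_ (sum_norm_geom_sum_rootExp_le hq.one_lt.le X))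
    refine Finset.sum_le_sum fun l _ => ?_
    rw [norm_mul, hval]
    exact mul_le_of_le_one_left (norm_nonneg _) (DirichletCharacter.norm_le_one _ _)
  rw [← hprod, norm_mul, hτn] at hbound
  have hsq : 0 < Real.sqrt q := Real.sqrt_pos.2 hqpos
  have hss := Real.mul_self_sqrt hqpos.le
  refine le_of_mul_le_mul_right (hbound.trans (le_of_eq ?_)) hsq
  linear_combination -(1 + Real.log q) * hss

/-- `z = e^{2πij/d}` for some integer `j` with `|j| ≤ M`. -/
def InArc (d M : ℕ) (z : ℂ) : Prop := ∃ j : ℤ, |j| ≤ M ∧ z = rootExp d j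

theorem geom_sum_eq_ite_of_pow_eq_one {d : ℕ} {z : ℂ} (hz : z ^ d = 1) :
    ∑ l ∈ Finset.range d, z ^ l = if z = 1 then (d : ℂ) else 0 := by
  split_ifs with h
  · simp [h]
  · rw [geom_sum_eq h, hz, sub_self, zero_div]

theorem dirichletCharacter_pow_orderOf {q : ℕ} (hq : q.Prime) (χ : DirichletCharacter ℂ q) {n : ℕ}
    (hn : 1 ≤ n) (hnq : n < q) : χ (n : ZMod q) ^ orderOf χ = 1 := by
  have : Fact q.Prime := ⟨hq⟩
  have hu : IsUnit (n : ZMod q) :=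
    (ZMod.isUnit_iff_coprime n q).2
      (Nat.Coprime.symm (hq.coprime_iff_not_dvd.2 (Nat.not_dvd_of_pos_of_lt hn hnq)))
  obtain ⟨u, hu⟩ := hu
  rw [← hu, ← MulChar.pow_apply_coe, pow_orderOf_eq_one, MulChar.one_apply_coe]

open Classical in
/-- Equidistribution of the values of `χ` on `d`-th roots of unity, in intervals longer than
`√q`. -/
theorem card_inArc_le {q : ℕ} (hq : q.Prime) (χ : DirichletCharacter ℂ q) {X : ℕ} (hX : X < q)
    (M : ℕ) :
    (((Finset.Icc 1 X).filter fun n : ℕ => InArc (orderOf χ) M (χ (n : ZMod q))).card : ℝ) ≤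
      X * ((2 * M + 1) / (orderOf χ : ℝ)) + Real.sqrt q * (1 + Real.log q) ^ 2 := by
  have : Fact q.Prime := ⟨hq⟩
  set d := orderOf χ with hd
  have hd0 : 0 < d := MulChar.orderOf_pos χ
  have hdpos : (0 : ℝ) < d := by exact_mod_cast hd0
  have hdq : d ≤ q := by
    have := Nat.le_of_dvd (by rw [ZMod.card]; have := hq.one_lt; omega)
      (MulChar.orderOf_dvd_card_sub_one (ZMod q) χ)
    rw [ZMod.card] at this
    omega
  set w : ℕ → ℂ := fun j => rootExp d ((j : ℤ) - M) with hw
  have hwd : ∀ j, w j ^ d = 1 := fun j => by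
    rw [hw, ← rootExp_nat_mul, rootExp_eq_one_iff hd0.ne']
    exact Dvd.intro _ rfl
  have hzd : ∀ n ∈ Finset.Icc 1 X, χ (n : ZMod q) ^ d = 1 := fun n hn => by
    rw [Finset.mem_Icc] at hn
    exact dirichletCharacter_pow_orderOf hq χ hn.1 (by omega)
  set J := Finset.range (2 * M + 1) with hJ
  -- the number of representations of the value `χ n` in the arc, by orthogonality
  have hF : ∀ n ∈ Finset.Icc 1 X,
      ∑ l ∈ Finset.range d, ∑ j ∈ J, χ (n : ZMod q) ^ l * w j ^ l =
        ((d * (J.filter fun j => χ (n : ZMod q) * w j = 1).card : ℕ) : ℂ) := by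
    intro n hn
    rw [Finset.sum_comm]
    have : ∀ j ∈ J, ∑ l ∈ Finset.range d, χ (n : ZMod q) ^ l * w j ^ l =
        if χ (n : ZMod q) * w j = 1 then (d : ℂ) else 0 := by
      intro j _
      simp_rw [← mul_pow]
      exact geom_sum_eq_ite_of_pow_eq_one (by rw [mul_pow, hzd n hn, hwd, mul_one])
    rw [Finset.sum_congr rfl this, ← Finset.sum_filter, Finset.sum_const, nsmul_eq_mul]
    push_cast
    ring
  have hone : ∀ n : ℕ, InArc d M (χ (n : ZMod q)) →
      1 ≤ (J.filter fun j => χ (n : ZMod q) * w j = 1).card := by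
    rintro n ⟨j, hj, hz⟩
    rw [abs_le] at hj
    refine Finset.card_pos.2 ⟨(M - j).toNat, Finset.mem_filter.2 ⟨?_, ?_⟩⟩
    · rw [hJ, Finset.mem_range]; omega
    · have e : (((M - j).toNat : ℕ) : ℤ) - M = -j := by omega
      rw [hz, hw]
      simp only [e]
      rw [← rootExp_add, add_neg_cancel, rootExp_zero]
  set S : ℕ → ℂ := fun l => ∑ n ∈ Finset.Icc 1 X, χ (n : ZMod q) ^ l with hS
  set T : ℕ → ℂ := fun l => ∑ j ∈ J, w j ^ l with hT
  have hlow : (d : ℝ) *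
      ((Finset.Icc 1 X).filter fun n : ℕ => InArc d M (χ (n : ZMod q))).card ≤
        ‖∑ l ∈ Finset.range d, S l * T l‖ := by
    have e : ∑ l ∈ Finset.range d, S l * T l = ((∑ n ∈ Finset.Icc 1 X,
        d * (J.filter fun j => χ (n : ZMod q) * w j = 1).card : ℕ) : ℂ) := by
      rw [Nat.cast_sum, ← Finset.sum_congr rfl hF, Finset.sum_comm]
      refine Finset.sum_congr rfl fun l _ => ?_
      rw [hS, hT, Finset.sum_mul_sum]
    rw [e, Complex.norm_natCast, ← Finset.mul_sum]
    push_cast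
    refine mul_le_mul_of_nonneg_left ?_ hdpos.le
    rw [Finset.card_filter]
    push_cast
    refine Finset.sum_le_sum fun n _ => ?_
    split_ifs with h
    · exact_mod_cast hone n h
    · positivity
  have hT' : ∀ l : ℕ, ‖T l‖ = ‖∑ n ∈ Finset.range (2 * M + 1), rootExp d l ^ n‖ := by
    intro l
    have : T l = rootExp d (l * -M) * ∑ n ∈ Finset.range (2 * M + 1), rootExp d l ^ n := by
      rw [hT, Finset.mul_sum]
      refine Finset.sum_congr rfl fun j _ => ?_
      rw [hw, ← rootExp_nat_mul, ← rootExp_nat_mul, ← rootExp_add]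
      congr 1
      ring
    rw [this, norm_mul, norm_rootExp, one_mul]
  have hS' : ∀ l ∈ Finset.Ico 1 d, ‖S l‖ ≤ Real.sqrt q * (1 + Real.log q) := by
    intro l hl
    rw [Finset.mem_Ico] at hl
    have hne : χ ^ l ≠ 1 := pow_ne_one_of_lt_orderOf (by omega) hl.2
    refine le_trans (le_of_eq ?_) (norm_sum_dirichletCharacter_le hq hne X)
    rw [hS]
    congr 1
    exact Finset.sum_congr rfl fun n _ => (MulChar.pow_apply' χ (by omega) _).symm
  have hlogq : 0 ≤ Real.log q := Real.log_natCast_nonneg q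
  have hup : ‖∑ l ∈ Finset.range d, S l * T l‖ ≤
      X * (2 * M + 1) + Real.sqrt q * (1 + Real.log q) * (d * (1 + Real.log q)) := by
    rw [Finset.range_eq_Ico, Finset.sum_eq_sum_Ico_succ_bot hd0]
    refine (norm_add_le _ _).trans (add_le_add ?_ ?_)
    · simp [hS, hT, hJ]
      norm_cast
    · refine (norm_sum_le _ _).trans ?_
      calc _ ≤ ∑ l ∈ Finset.Ico 1 d, Real.sqrt q * (1 + Real.log q) *
            ‖∑ n ∈ Finset.range (2 * M + 1), rootExp d l ^ n‖ := by
            refine Finset.sum_le_sum fun l hl => ?_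
            rw [norm_mul, hT']
            exact mul_le_mul_of_nonneg_right (hS' l hl) (norm_nonneg _)
        _ ≤ Real.sqrt q * (1 + Real.log q) * (d * (1 + Real.log d)) := by
            rw [← Finset.mul_sum]
            exact mul_le_mul_of_nonneg_left (sum_norm_geom_sum_rootExp_le hd0 _) (by positivity)
        _ ≤ _ := by gcongr
  have := hlow.trans hup
  refine le_of_mul_le_mul_left (this.trans (le_of_eq ?_)) hdpos
  field_simp

/-! ### Smooth numbers -/

theorem log_le_half_sub_inv {a : ℝ} (ha : 1 ≤ a) : Real.log a ≤ (a - a⁻¹) / 2 := by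
  rw [← Real.sinh_log (by linarith)]
  exact Real.self_le_sinh_iff.2 (Real.log_nonneg ha)

theorem two_mul_sub_div_add_le_log {a : ℝ} (ha : 1 ≤ a) : 2 * (a - 1) / (a + 1) ≤ Real.log a := by
  have := Real.le_log_one_add_of_nonneg (show 0 ≤ a - 1 by linarith)
  rwa [show a - 1 + 2 = a + 1 by ring, show 1 + (a - 1) = a by ring] at this

/-- All prime factors of `n` are at most `y`. -/
def IsSmooth (y : ℝ) (n : ℕ) : Prop := ∀ p : ℕ, p.Prime → p ∣ n → (p : ℝ) ≤ y

open Classical in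
/-- The number of `y`-smooth positive integers up to `x`. -/
noncomputable def smoothCount (x y : ℝ) : ℕ := ((Finset.Icc 1 ⌊x⌋₊).filter (IsSmooth y)).card

theorem card_filter_dvd_Icc_le (X m : ℕ) :
    (((Finset.Icc 1 X).filter fun n => m ∣ n).card : ℝ) ≤ X * (1 / (m : ℝ)) := by
  have h : Finset.Icc 1 X = Finset.Ioc 0 X := rfl
  rw [h, Nat.Ioc_filter_dvd_card_eq_div, mul_one_div]
  exact Nat.cast_div_le

open Classical in
theorem card_filter_exists_dvd_le {ι : Type*} (T : Finset ι) (f : ι → ℕ) (X : ℕ) :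
    (((Finset.Icc 1 X).filter fun n => ∃ t ∈ T, f t ∣ n).card : ℝ) ≤
      X * ∑ t ∈ T, 1 / (f t : ℝ) := by
  have h1 : (Finset.Icc 1 X).filter (fun n => ∃ t ∈ T, f t ∣ n) ⊆
      T.biUnion fun t => (Finset.Icc 1 X).filter fun n => f t ∣ n := by
    intro n hn
    obtain ⟨hn1, t, ht, htn⟩ := Finset.mem_filter.1 hn
    exact Finset.mem_biUnion.2 ⟨t, ht, Finset.mem_filter.2 ⟨hn1, htn⟩⟩
  have h2 := (Finset.card_le_card h1).trans Finset.card_biUnion_le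
  rw [Finset.mul_sum]
  calc _ ≤ ((∑ t ∈ T, ((Finset.Icc 1 X).filter fun n => f t ∣ n).card : ℕ) : ℝ) := by
        exact_mod_cast h2
    _ ≤ _ := by
        push_cast
        exact Finset.sum_le_sum fun t _ => card_filter_dvd_Icc_le X (f t)

theorem mem_primes_Ioc {A B : ℝ} (hA : 0 ≤ A) {p : ℕ} (hp : p.Prime) (h1 : A < p)
    (h2 : (p : ℝ) ≤ B) : p ∈ (Finset.Ioc ⌊A⌋₊ ⌊B⌋₊).filter Nat.Prime :=
  Finset.mem_filter.2 ⟨Finset.mem_Ioc.2 ⟨(Nat.floor_lt hA).2 h1, Nat.le_floor h2⟩, hp⟩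

open Classical in
theorem card_exists_prime_dvd_le {A : ℝ} (hA : 0 ≤ A) (B : ℝ) (X : ℕ) :
    (((Finset.Icc 1 X).filter fun n =>
      ∃ p : ℕ, p.Prime ∧ A < p ∧ (p : ℝ) ≤ B ∧ p ∣ n).card : ℝ) ≤ X * primeRecipSum A B := by
  refine (Nat.cast_le.2 (Finset.card_le_card fun n hn => ?_)).trans
    (card_filter_exists_dvd_le ((Finset.Ioc ⌊A⌋₊ ⌊B⌋₊).filter Nat.Prime) (fun p => p) X)
  obtain ⟨hn1, p, hp, h1, h2, h3⟩ := Finset.mem_filter.1 hn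
  exact Finset.mem_filter.2 ⟨hn1, p, mem_primes_Ioc hA hp h1 h2, h3⟩

open Classical in
theorem card_exists_prime_mul_dvd_le {A A' : ℝ} (hA : 0 ≤ A) (hA' : 0 ≤ A') (B B' : ℝ) (X : ℕ) :
    (((Finset.Icc 1 X).filter fun n =>
      ∃ p p' : ℕ, p.Prime ∧ p'.Prime ∧ A < p ∧ (p : ℝ) ≤ B ∧ A' < p' ∧ (p' : ℝ) ≤ B' ∧
        p * p' ∣ n).card : ℝ) ≤ X * (primeRecipSum A B * primeRecipSum A' B') := by
  have h := card_filter_exists_dvd_le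
    (((Finset.Ioc ⌊A⌋₊ ⌊B⌋₊).filter Nat.Prime) ×ˢ ((Finset.Ioc ⌊A'⌋₊ ⌊B'⌋₊).filter Nat.Prime))
    (fun t => t.1 * t.2) X
  have e : ∑ t ∈ ((Finset.Ioc ⌊A⌋₊ ⌊B⌋₊).filter Nat.Prime) ×ˢ
      ((Finset.Ioc ⌊A'⌋₊ ⌊B'⌋₊).filter Nat.Prime), 1 / ((t.1 * t.2 : ℕ) : ℝ) =
        primeRecipSum A B * primeRecipSum A' B' := by
    unfold primeRecipSum
    rw [Finset.sum_mul_sum, ← Finset.sum_product']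
    refine Finset.sum_congr rfl fun t _ => ?_
    push_cast
    rw [one_div_mul_one_div]
  rw [e] at h
  refine (Nat.cast_le.2 (Finset.card_le_card fun n hn => ?_)).trans h
  obtain ⟨hn1, p, p', hp, hp', h1, h2, h3, h4, h5⟩ := Finset.mem_filter.1 hn
  exact Finset.mem_filter.2 ⟨hn1, (p, p'), Finset.mem_product.2 ⟨mem_primes_Ioc hA hp h1 h2,
    mem_primes_Ioc hA' hp' h3 h4⟩, h5⟩

open Classical in
/-- Integers that are not `y`-smooth are multiples of some prime `p ∈ (y, x]`. -/
theorem floor_mul_one_sub_le_smoothCount {x y : ℝ} (hy : 0 ≤ y) :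
    (⌊x⌋₊ : ℝ) * (1 - primeRecipSum y x) ≤ smoothCount x y := by
  have hc := Finset.card_filter_add_card_filter_not (s := Finset.Icc 1 ⌊x⌋₊) (IsSmooth y)
  have hbad := card_exists_prime_dvd_le hy x ⌊x⌋₊
  have hsub : ((Finset.Icc 1 ⌊x⌋₊).filter fun n => ¬IsSmooth y n) ⊆
      (Finset.Icc 1 ⌊x⌋₊).filter fun n =>
        ∃ p : ℕ, p.Prime ∧ y < p ∧ (p : ℝ) ≤ x ∧ p ∣ n := by
    intro n hn
    obtain ⟨hn1, hn2⟩ := Finset.mem_filter.1 hn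
    rw [IsSmooth] at hn2
    push Not at hn2
    obtain ⟨p, hp, hpn, hpy⟩ := hn2
    have hn1' := Finset.mem_Icc.1 hn1
    refine Finset.mem_filter.2 ⟨hn1, p, hp, hpy, ?_, hpn⟩
    have h1 : p ≤ ⌊x⌋₊ := (Nat.le_of_dvd (by omega) hpn).trans hn1'.2
    exact (Nat.le_floor_iff' hp.ne_zero).1 h1
  have h2 : ((((Finset.Icc 1 ⌊x⌋₊).filter fun n => ¬IsSmooth y n).card : ℕ) : ℝ) ≤ _ :=
    (Nat.cast_le.2 (Finset.card_le_card hsub)).trans hbad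
  rw [Nat.card_Icc, Nat.add_sub_cancel] at hc
  have hc' : (((Finset.Icc 1 ⌊x⌋₊).filter (IsSmooth y)).card : ℝ) +
      (((Finset.Icc 1 ⌊x⌋₊).filter fun n => ¬IsSmooth y n).card : ℝ) = ⌊x⌋₊ := by
    exact_mod_cast hc
  unfold smoothCount
  linarith

open Classical in
/-- Counting `∑ log n` over smooth `n ≤ x` via `log n = ∑_{m ∣ n} Λ(m)`. -/
theorem sum_mangoldt_mul_smoothCount_le (x y : ℝ) :
    ∑ m ∈ Finset.Ioc 0 ⌊y⌋₊, ArithmeticFunction.vonMangoldt m * smoothCount (x / m) y ≤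
      Real.log x * smoothCount x y := by
  set S := (Finset.Icc 1 ⌊x⌋₊).filter (IsSmooth y) with hS
  have hcard : ∀ m ∈ Finset.Ioc 0 ⌊y⌋₊, smoothCount (x / m) y ≤ (S.filter fun n => m ∣ n).card := by
    intro m hm
    rw [Finset.mem_Ioc] at hm
    have hm0 : (0 : ℝ) < m := by exact_mod_cast hm.1
    refine Finset.card_le_card_of_injOn (fun k => m * k) ?_ ?_
    · intro k hk
      obtain ⟨hk1, hk2⟩ := Finset.mem_filter.1 hk
      rw [Finset.mem_Icc] at hk1
      have hkx : (k : ℝ) ≤ x / m := (Nat.le_floor_iff' (by omega)).1 hk1.2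
      refine Finset.mem_filter.2 ⟨Finset.mem_filter.2 ⟨Finset.mem_Icc.2 ⟨?_, ?_⟩, ?_⟩,
        dvd_mul_right _ _⟩
      · exact Nat.mul_pos hm.1 hk1.1
      · refine Nat.le_floor ?_
        push_cast
        rw [le_div_iff₀ hm0] at hkx
        linarith
      · intro p hp hpd
        rcases (Nat.Prime.dvd_mul hp).1 hpd with h | h
        · exact (Nat.le_floor_iff' hp.ne_zero).1 ((Nat.le_of_dvd hm.1 h).trans hm.2)
        · exact hk2 p hp h
    · intro a _ b _ hab
      exact Nat.eq_of_mul_eq_mul_left hm.1 hab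
  calc _ ≤ ∑ m ∈ Finset.Ioc 0 ⌊y⌋₊, ArithmeticFunction.vonMangoldt m *
        (∑ n ∈ S, if m ∣ n then (1 : ℝ) else 0) := by
        refine Finset.sum_le_sum fun m hm => ?_
        refine mul_le_mul_of_nonneg_left ?_ ArithmeticFunction.vonMangoldt_nonneg
        rw [← Finset.sum_filter, Finset.sum_const, nsmul_eq_mul, mul_one]
        exact_mod_cast hcard m hm
    _ = ∑ n ∈ S, ∑ m ∈ Finset.Ioc 0 ⌊y⌋₊,
          if m ∣ n then ArithmeticFunction.vonMangoldt m else 0 := by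
        simp_rw [Finset.mul_sum]
        rw [Finset.sum_comm]
        simp only [mul_ite, mul_one, mul_zero]
    _ ≤ ∑ n ∈ S, Real.log n := by
        refine Finset.sum_le_sum fun n hn => ?_
        have hn1 := Finset.mem_Icc.1 (Finset.mem_filter.1 hn).1
        rw [← ArithmeticFunction.vonMangoldt_sum, ← Finset.sum_filter]
        refine Finset.sum_le_sum_of_subset_of_nonneg (fun m hm => ?_)
          fun _ _ _ => ArithmeticFunction.vonMangoldt_nonneg
        exact Nat.mem_divisors.2 ⟨(Finset.mem_filter.1 hm).2, by omega⟩
    _ ≤ ∑ n ∈ S, Real.log x := by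
        refine Finset.sum_le_sum fun n hn => ?_
        have hn1 := Finset.mem_Icc.1 (Finset.mem_filter.1 hn).1
        refine Real.log_le_log (by exact_mod_cast hn1.1) ?_
        exact (Nat.le_floor_iff' (by omega)).1 hn1.2
    _ = _ := by
        rw [Finset.sum_const, nsmul_eq_mul, mul_comm]
        rfl

/-- The minorant of the density of smooth numbers: `0.9 * 2^w * ρ(w)` at
`w = 2 * log x / log y`. -/
noncomputable def smoothMinorant (w : ℝ) : ℝ := 9 / 10 * ((2 : ℝ) ^ w * dickmanRho w)

theorem smoothMinorant_nonneg (w : ℝ) : 0 ≤ smoothMinorant w := by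
  have := dickmanRho_pos w
  unfold smoothMinorant
  positivity

theorem smoothMinorant_antitone {a b : ℝ} (ha : 2 ≤ a) (hab : a ≤ b) :
    smoothMinorant b ≤ smoothMinorant a := by
  have := antitoneOn_two_rpow_mul_dickmanRho (show a ∈ Set.Ici (2 : ℝ) from ha)
    (show b ∈ Set.Ici (2 : ℝ) from ha.trans hab) hab
  unfold smoothMinorant
  exact mul_le_mul_of_nonneg_left this (by norm_num)

theorem sub_half_mul_smoothMinorant_le {w : ℝ} (hw : 2 ≤ w) :
    (w - 1 / 2) * smoothMinorant w ≤ smoothMinorant (w - 1) := by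
  have h1 := two_mul_sub_one_mul_dickmanRho_le hw
  have h2 : (2 : ℝ) ^ (w - 1) = 2 ^ w / 2 := by
    rw [Real.rpow_sub (by norm_num), Real.rpow_one]
  have h3 : (0 : ℝ) < 2 ^ w := by positivity
  unfold smoothMinorant
  rw [h2]
  nlinarith [mul_le_mul_of_nonneg_left h1 h3.le]

theorem smoothMinorant_three_le : smoothMinorant 3 ≤ 0.442 := by
  have h1 := two_mul_sub_one_mul_dickmanRho_le (show (2 : ℝ) ≤ 3 by norm_num)
  norm_num at h1
  rw [dickmanRho_eq_one_sub_log one_le_two (le_refl 2)] at h1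
  have h2 : (2 : ℝ) ^ (3 : ℝ) = 8 := by norm_num
  unfold smoothMinorant
  rw [h2]
  linarith [Real.log_two_gt_d9]

theorem smoothMinorant_seventeen_fifths_le : smoothMinorant (17 / 5) ≤ 0.28 := by
  have h1 := two_mul_sub_one_mul_dickmanRho_le (show (2 : ℝ) ≤ 17 / 5 by norm_num)
  have h2 := dickmanRho_le_of_mem_Icc_two_three (show (2 : ℝ) ≤ 12 / 5 by norm_num) (by norm_num)
  have h3 : Real.log (12 / 5) = Real.log 2 + Real.log (6 / 5) := by
    rw [← Real.log_mul (by norm_num) (by norm_num)]; norm_num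
  have h4 := two_mul_sub_div_add_le_log (show (1 : ℝ) ≤ 6 / 5 by norm_num)
  norm_num at h1 h4
  have h5 : (2 : ℝ) ^ (17 / 5 : ℝ) ≤ 10.6 := by
    rw [← pow_le_pow_iff_left₀ (by positivity) (by norm_num) (show 5 ≠ 0 by norm_num),
      ← Real.rpow_mul_natCast (by norm_num)]
    norm_num
  unfold smoothMinorant
  have h6 : dickmanRho (17 / 5) ≤ 0.028 := by
    linarith [Real.log_two_gt_d9]
  have h7 := mul_le_mul h5 h6 (dickmanRho_pos _).le (by norm_num)
  linarith

/-- The start of the induction: for `y ≤ x ≤ y²` the minorant, frozen below `w = 3`, lies under the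
density `1 - log v`, `v = log x / log y`. -/
theorem smoothMinorant_le_of_le_two {v : ℝ} (h1 : 1 ≤ v) (h2 : v ≤ 2) :
    smoothMinorant (max (2 * v) 3) ≤ 1 - Real.log v - 0.02 := by
  have hl2 := Real.log_two_lt_d9
  rcases le_total v (17 / 10) with h | h
  · have h3 := smoothMinorant_antitone (show (2 : ℝ) ≤ 3 by norm_num) (le_max_right (2 * v) 3)
    have h4 : Real.log v ≤ Real.log (17 / 10) := Real.log_le_log (by linarith) h
    have h5 : Real.log (17 / 10) = Real.log 2 - Real.log (20 / 17) := by
      rw [← Real.log_div (by norm_num) (by norm_num)]; norm_num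
    have h6 := two_mul_sub_div_add_le_log (show (1 : ℝ) ≤ 20 / 17 by norm_num)
    norm_num at h6
    linarith [smoothMinorant_three_le]
  · have h3 := smoothMinorant_antitone (show (2 : ℝ) ≤ 17 / 5 by norm_num)
      (show 17 / 5 ≤ max (2 * v) 3 from le_max_of_le_left (by linarith))
    have h4 : Real.log v ≤ Real.log 2 := Real.log_le_log (by linarith) h2
    linarith [smoothMinorant_seventeen_fifths_le]

theorem one_sub_log_le_smoothCount {x y : ℝ} (hy : 450 ≤ Real.log y) (hyx : y ≤ x)
    (hx : Real.log x ≤ 2 * Real.log y) (hy0 : 0 < y) :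
    (1 - Real.log (Real.log x / Real.log y) - 0.02) * x ≤ smoothCount x y := by
  have hy2 : Real.log y ≤ y - 1 := Real.log_le_sub_one_of_pos hy0
  have hS := primeRecipSum_le (show 2 ≤ y by linarith) hyx
  have h0 := floor_mul_one_sub_le_smoothCount (x := x) hy0.le
  have hxf := Nat.lt_floor_add_one x
  have h8 : 8 / Real.log y ≤ 0.01778 := by
    rw [div_le_iff₀ (by linarith)]; linarith
  have hSn := primeRecipSum_nonneg y x
  set S := primeRecipSum y x
  have hlv : Real.log (Real.log x / Real.log y) ≤ 0.694 := by
    have : Real.log (Real.log x / Real.log y) ≤ Real.log 2 := by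
      have hlx : Real.log y ≤ Real.log x := Real.log_le_log hy0 hyx
      refine Real.log_le_log (div_pos (by linarith) (by linarith)) ?_
      rw [div_le_iff₀ (by linarith)]; exact hx
    linarith [Real.log_two_lt_d9]
  set v := Real.log (Real.log x / Real.log y)
  have h1 : (x - 1) * (1 - S) ≤ ⌊x⌋₊ * (1 - S) :=
    mul_le_mul_of_nonneg_right (by linarith) (by linarith)
  have h2 : (1 - v - 0.02) * x ≤ (x - 1) * (1 - S) := by
    have h3 := mul_le_mul_of_nonneg_right (show S ≤ v + 0.01778 by linarith)
      (show 0 ≤ x by linarith)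
    linarith
  linarith

/-- The lower bound for smooth numbers by induction on the size of `x`. The terms of
`∑ Λ(m) Ψ(x/m, y) ≤ log x · Ψ(x, y)` with `m ≤ √y` are bounded with the minorant at `w` and those
with `√y < m ≤ y` with the minorant at `w - 1`. -/
theorem smoothMinorant_mul_le_smoothCount_of_le_two_pow {y : ℝ} (hy0 : 0 < y)
    (hy : 450 ≤ Real.log y) (n : ℕ) : ∀ x : ℝ, x ≤ 2 ^ n → y ≤ x →
      64 * Real.log x ≤ Real.log y ^ 2 →
      smoothMinorant (max (2 * (Real.log x / Real.log y)) 3) * x ≤ smoothCount x y := by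
  have hl : 0 < Real.log y := by linarith
  have hy1 : 450 < y := by linarith [Real.log_le_sub_one_of_pos hy0]
  induction n with
  | zero =>
    intro x hx hyx
    norm_num at hx
    linarith
  | succ n ih =>
    intro x hx hyx hc
    have hx0 : 0 < x := by linarith
    have hlxy : Real.log y ≤ Real.log x := Real.log_le_log hy0 hyx
    rcases le_total (Real.log x) (2 * Real.log y) with hcase | hcase
    · refine le_trans ?_ (one_sub_log_le_smoothCount hy hyx hcase hy0)
      refine mul_le_mul_of_nonneg_right (smoothMinorant_le_of_le_two ?_ ?_) hx0.le
      · rw [le_div_iff₀ hl]; linarith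
      · rw [div_le_iff₀ hl]; exact hcase
    set w := 2 * (Real.log x / Real.log y) with hw
    have hwl : w * Real.log y = 2 * Real.log x := by rw [hw]; field_simp
    have hw4 : 4 ≤ w := by
      by_contra h
      nlinarith
    have hw32 : 32 * w ≤ Real.log y := by
      by_contra h
      nlinarith
    rw [max_eq_left (by linarith)]
    have hrec := sum_mangoldt_mul_smoothCount_le x y
    have hsq0 : 0 < Real.sqrt y := Real.sqrt_pos.2 hy0
    have hsqy : Real.sqrt y ≤ y := by
      rw [Real.sqrt_le_left hy0.le]; nlinarith
    have hlsq : Real.log (Real.sqrt y) = Real.log y / 2 := Real.log_sqrt hy0.le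
    have hsq1 : 1 ≤ Real.sqrt y := by
      rw [Real.one_le_sqrt]; linarith
    have hfl : ⌊Real.sqrt y⌋₊ ≤ ⌊y⌋₊ := Nat.floor_le_floor hsqy
    have hm : ∀ m ∈ Finset.Ioc 0 ⌊y⌋₊, ∀ c : ℝ,
        (2 ≤ m → c * (x / m) ≤ smoothCount (x / m) y) →
        c * x * (ArithmeticFunction.vonMangoldt m / m) ≤
          ArithmeticFunction.vonMangoldt m * smoothCount (x / m) y := by
      intro m hm c hcm
      rw [Finset.mem_Ioc] at hm
      rcases Nat.lt_or_ge m 2 with h | h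
      · have : m = 1 := by omega
        subst this
        simp
      · have := mul_le_mul_of_nonneg_left (hcm h)
          (ArithmeticFunction.vonMangoldt_nonneg (n := m))
        refine le_trans (le_of_eq ?_) this
        ring
    have hxm : ∀ m : ℕ, 2 ≤ m → (m : ℝ) ≤ y → ∀ w' : ℝ, 3 ≤ w' →
        2 * (Real.log (x / m) / Real.log y) ≤ w' →
        smoothMinorant w' * (x / m) ≤ smoothCount (x / m) y := by
      intro m hm2 hmy w' hw' hle
      have hm2' : (2 : ℝ) ≤ m := by exact_mod_cast hm2
      have hm0 : (0 : ℝ) < m := by linarith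
      have hlm : 0 ≤ Real.log m := Real.log_nonneg (by linarith)
      have hlog : Real.log (x / m) = Real.log x - Real.log m := Real.log_div hx0.ne' hm0.ne'
      have h1 := ih (x / m)
        (by rw [div_le_iff₀ hm0]; rw [pow_succ] at hx; nlinarith [pow_pos (two_pos (α := ℝ)) n])
        (by
          rw [le_div_iff₀ hm0]
          have : y * y ≤ x := by
            rw [← Real.log_le_log_iff (by positivity) hx0, Real.log_mul hy0.ne' hy0.ne']
            linarith
          nlinarith)
        (by rw [hlog]; linarith)
      refine le_trans (mul_le_mul_of_nonneg_right ?_ (by positivity)) h1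
      exact smoothMinorant_antitone (le_max_of_le_right (by norm_num)) (max_le hle hw')
    have hlogm : ∀ m : ℕ, 1 ≤ m → 2 * (Real.log (x / m) / Real.log y) =
        w - 2 * (Real.log m / Real.log y) := by
      intro m hm1
      rw [Real.log_div hx0.ne' (by positivity), hw]
      ring
    have hA : smoothMinorant w * x * mangoldtSum (Real.sqrt y) ≤
        ∑ m ∈ Finset.Ioc 0 ⌊Real.sqrt y⌋₊,
          ArithmeticFunction.vonMangoldt m * smoothCount (x / m) y := by
      rw [mangoldtSum_eq_sum_Ioc, Finset.mul_sum]
      refine Finset.sum_le_sum fun m hmem => ?_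
      rw [Finset.mem_Ioc] at hmem
      refine hm m (Finset.mem_Ioc.2 ⟨hmem.1, hmem.2.trans hfl⟩) _ fun h2 => ?_
      have hmy : (m : ℝ) ≤ y := (Nat.le_floor_iff' (by omega)).1 (hmem.2.trans hfl)
      refine hxm m h2 hmy w (by linarith) ?_
      rw [hlogm m hmem.1]
      have : 0 ≤ Real.log m / Real.log y := div_nonneg (Real.log_natCast_nonneg m) hl.le
      linarith
    have hB : smoothMinorant (w - 1) * x * (mangoldtSum y - mangoldtSum (Real.sqrt y)) ≤
        ∑ m ∈ Finset.Ioc ⌊Real.sqrt y⌋₊ ⌊y⌋₊,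
          ArithmeticFunction.vonMangoldt m * smoothCount (x / m) y := by
      have e : mangoldtSum y - mangoldtSum (Real.sqrt y) =
          ∑ m ∈ Finset.Ioc ⌊Real.sqrt y⌋₊ ⌊y⌋₊, ArithmeticFunction.vonMangoldt m / (m : ℝ) := by
        rw [mangoldtSum_eq_sum_Ioc, mangoldtSum_eq_sum_Ioc,
          ← Finset.sum_Ioc_consecutive _ (Nat.zero_le _) hfl]
        ring
      rw [e, Finset.mul_sum]
      refine Finset.sum_le_sum fun m hmem => ?_
      rw [Finset.mem_Ioc] at hmem
      refine hm m (Finset.mem_Ioc.2 ⟨by omega, hmem.2⟩) _ fun h2 => ?_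
      have hmy : (m : ℝ) ≤ y := (Nat.le_floor_iff' (by omega)).1 hmem.2
      have hms : Real.sqrt y < m := (Nat.floor_lt hsq0.le).1 hmem.1
      refine hxm m h2 hmy (w - 1) (by linarith) ?_
      rw [hlogm m (by omega)]
      have h3 : Real.log y / 2 ≤ Real.log m := hlsq ▸ Real.log_le_log hsq0 hms.le
      have h4 : 1 / 2 ≤ Real.log m / Real.log y := by
        rw [le_div_iff₀ hl]; linarith
      linarith
    rw [← Finset.sum_Ioc_consecutive _ (Nat.zero_le _) hfl] at hrec
    have hMa := log_sub_two_le_mangoldtSum hsq1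
    have hMa' := mangoldtSum_le_log_add_six hsq1
    have hMb := log_sub_two_le_mangoldtSum (show 1 ≤ y by linarith)
    rw [hlsq] at hMa hMa'
    have hF := sub_half_mul_smoothMinorant_le (show 2 ≤ w by linarith)
    have hF0 := smoothMinorant_nonneg w
    set F := smoothMinorant w
    set G := smoothMinorant (w - 1)
    -- the decay factor `w - 1/2` of the minorant outweighs the Mertens error terms
    have hG0 : 0 ≤ (w - 1 / 2) * F := mul_nonneg (by linarith) hF0
    have h1 : F * x * (Real.log y / 2 - 2) ≤ F * x * mangoldtSum (Real.sqrt y) :=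
      mul_le_mul_of_nonneg_left hMa (by positivity)
    have h2 : (w - 1 / 2) * F * x * (Real.log y / 2 - 8) ≤
        G * x * (mangoldtSum y - mangoldtSum (Real.sqrt y)) :=
      mul_le_mul (mul_le_mul_of_nonneg_right hF hx0.le) (by linarith) (by linarith)
        (mul_nonneg (smoothMinorant_nonneg _) hx0.le)
    have h3 : F * x * Real.log x ≤ F * x * (Real.log y / 2 - 2) +
        (w - 1 / 2) * F * x * (Real.log y / 2 - 8) := by
      have e : F * x * (Real.log y / 2 - 2) + (w - 1 / 2) * F * x * (Real.log y / 2 - 8) =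
          F * x * (w * Real.log y / 2 + Real.log y / 4 + 2 - 8 * w) := by ring
      rw [e]
      refine mul_le_mul_of_nonneg_left ?_ (by positivity)
      rw [hwl]
      linarith
    have h4 : Real.log x * (F * x) ≤ Real.log x * smoothCount x y := by linarith
    exact le_of_mul_le_mul_left h4 (by linarith)

theorem smoothMinorant_mul_le_smoothCount {x y : ℝ} (hy0 : 0 < y) (hy : 450 ≤ Real.log y)
    (hyx : y ≤ x) (hx : 64 * Real.log x ≤ Real.log y ^ 2) :
    smoothMinorant (max (2 * (Real.log x / Real.log y)) 3) * x ≤ smoothCount x y := by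
  obtain ⟨n, hn⟩ := pow_unbounded_of_one_lt x (one_lt_two)
  exact smoothMinorant_mul_le_smoothCount_of_le_two_pow hy0 hy n x hn.le hyx hx

/-! ### Propagation of arc constraints to smooth numbers -/

theorem InArc.mono {d M N : ℕ} {z : ℂ} (h : InArc d M z) (hMN : M ≤ N) : InArc d N z := by
  obtain ⟨j, hj, hz⟩ := h
  exact ⟨j, hj.trans (by exact_mod_cast hMN), hz⟩

theorem InArc.mul {d M N : ℕ} {z w : ℂ} (hz : InArc d M z) (hw : InArc d N w) :
    InArc d (M + N) (z * w) := by
  obtain ⟨i, hi, rfl⟩ := hz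
  obtain ⟨j, hj, rfl⟩ := hw
  refine ⟨i + j, (abs_add_le i j).trans ?_, (rootExp_add d i j).symm⟩
  push_cast
  exact add_le_add hi hj

theorem inArc_one (d M : ℕ) : InArc d M 1 := ⟨0, by simp, (rootExp_zero d).symm⟩

theorem exists_eq_rootExp_of_pow_eq_one {d : ℕ} (hd : 0 < d) {z : ℂ} (hz : z ^ d = 1) :
    ∃ j : ℤ, z = rootExp d j ∧ |(j : ℝ)| = d * |unitArg z| := by
  have hdpos : (0 : ℝ) < d := by exact_mod_cast hd
  have hdc : (d : ℂ) ≠ 0 := by exact_mod_cast hd.ne'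
  have hnorm : ‖z‖ = 1 := Complex.norm_eq_one_of_pow_eq_one hz hd.ne'
  have hexp := exp_unitArg z hnorm
  have h1 : Complex.exp (d * (2 * Real.pi * Complex.I * (unitArg z : ℂ))) = 1 := by
    rw [Complex.exp_nat_mul, hexp, hz]
  obtain ⟨j, hj⟩ := Complex.exp_eq_one_iff.1 h1
  have h2 : (d : ℂ) * unitArg z = j := by
    have : (2 * Real.pi * Complex.I : ℂ) * (d * unitArg z) = (2 * Real.pi * Complex.I) * j := by
      linear_combination hj
    exact mul_left_cancel₀ Complex.two_pi_I_ne_zero this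
  have h3 : (d : ℝ) * unitArg z = j := by exact_mod_cast h2
  refine ⟨j, ?_, ?_⟩
  · rw [← hexp]
    unfold rootExp
    congr 1
    rw [← h2]
    field_simp
  · rw [← h3, abs_mul, abs_of_pos hdpos]

/-- The strict inequality `|j| < d r` for an integer `j` is `|j| ≤ ⌈d r⌉ - 1`. The truncated
subtraction is harmless, since `d r > 0`. -/
theorem inArc_of_abs_unitArg_lt {d : ℕ} (hd : 0 < d) {z : ℂ} (hz : z ^ d = 1) {r : ℝ}
    (h : |unitArg z| < r) : InArc d (⌈d * r⌉₊ - 1) z := by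
  obtain ⟨j, hj, habs⟩ := exists_eq_rootExp_of_pow_eq_one hd hz
  refine ⟨j, ?_, hj⟩
  have hdpos : (0 : ℝ) < d := by exact_mod_cast hd
  have h1 : ((j.natAbs : ℕ) : ℝ) < d * r := by
    rw [Nat.cast_natAbs, Int.cast_abs, habs]
    exact mul_lt_mul_of_pos_left h hdpos
  have h2 := Nat.lt_ceil.2 h1
  rw [Int.abs_eq_natAbs]
  omega

/-- If `z` and `z²` both lie in a short arc about `1`, then `z` lies in the arc of half the
length. -/
theorem InArc.half {d J : ℕ} (hd : 3 * J < d) {z : ℂ} (h1 : InArc d J z) (h2 : InArc d J (z ^ 2)) :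
    InArc d (J / 2) z := by
  obtain ⟨j, hj, rfl⟩ := h1
  obtain ⟨i, hi, h⟩ := h2
  rw [← rootExp_nat_mul] at h
  have h3 : rootExp d (((2 : ℕ) : ℤ) * j - i) = 1 := by
    rw [sub_eq_add_neg, rootExp_add, h, ← rootExp_add, add_neg_cancel, rootExp_zero]
  rw [rootExp_eq_one_iff (by omega)] at h3
  rw [abs_le] at hi hj
  have h4 : ((2 : ℕ) : ℤ) * j - i = 0 := by
    refine Int.eq_zero_of_abs_lt_dvd h3 ?_
    rw [abs_lt]
    push_cast
    omega
  refine ⟨j, ?_, rfl⟩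
  rw [abs_le]
  push_cast at h4 ⊢
  omega

theorem eq_one_of_inArc_seven_two {z : ℂ} (h1 : InArc 7 2 z) (h2 : InArc 7 2 (z ^ 2))
    (h3 : InArc 7 2 (z ^ 3)) : z = 1 := by
  obtain ⟨j, hj, rfl⟩ := h1.half (by norm_num) h2
  obtain ⟨i, hi, h⟩ := h3
  rw [← rootExp_nat_mul] at h
  have h3 : rootExp 7 (((3 : ℕ) : ℤ) * j - i) = 1 := by
    rw [sub_eq_add_neg, rootExp_add, h, ← rootExp_add, add_neg_cancel, rootExp_zero]
  rw [rootExp_eq_one_iff (by omega)] at h3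
  rw [abs_le] at hi hj
  have h4 : j = 0 := by
    push_cast at h3 hi hj
    omega
  rw [h4, rootExp_zero]

theorem IsSmooth.of_dvd {y : ℝ} {m n : ℕ} (h : IsSmooth y n) (hmn : m ∣ n) : IsSmooth y m :=
  fun p hp hpm => h p hp (hpm.trans hmn)

section
variable {f : ℕ → ℂ} {d J : ℕ} {y : ℝ}

/-- A smooth number is a product of `k` factors `≤ y`, obtained by adding one prime at a time and
merging it with an earlier factor if the product stays `≤ y`; the last alternative records that
`k < 2 * log n / log y` when `k ≥ 2`. -/
theorem exists_inArc_of_isSmooth (hf : ∀ a b, f (a * b) = f a * f b) (hy : 1 ≤ y)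
    (hJ : ∀ n : ℕ, 1 ≤ n → (n : ℝ) ≤ y → InArc d J (f n)) (hf1 : f 1 = 1) {n : ℕ} (hn : 1 ≤ n)
    (hs : IsSmooth y n) :
    ∃ k : ℕ, InArc d (k * J) (f n) ∧ (k ≤ 1 ∨ y ^ k < (n : ℝ) ^ 2) := by
  -- `a ≤ b` are two current factors with `a * b > y`, and `c` is the product of the `k` others;
  -- each of these was the larger one of an earlier pair and has square `> y`, so that `c² ≥ y ^ k`
  have key : ∀ n : ℕ, 1 ≤ n → IsSmooth y n → (n : ℝ) ≤ y ∨ ∃ a b c k : ℕ, n = a * b * c ∧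
      1 ≤ a ∧ a ≤ b ∧ 1 ≤ c ∧ (b : ℝ) ≤ y ∧ y < a * b ∧ y ^ k ≤ (c : ℝ) ^ 2 ∧
      InArc d (k * J) (f c) := by
    intro n
    induction n using Nat.strong_induction_on with
    | _ n ih =>
      intro hn hs
      rcases hn.eq_or_lt with h1 | h1
      · left; rw [← h1]; simpa using hy
      have hp := Nat.minFac_prime (show n ≠ 1 by omega)
      obtain ⟨m, hm⟩ := Nat.minFac_dvd n
      set p := n.minFac
      have hm1 : 1 ≤ m := by
        rcases Nat.eq_zero_or_pos m with h | h
        · subst h; omega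
        · exact h
      have hpy : (p : ℝ) ≤ y := hs p hp ⟨m, hm⟩
      have hmn : m < n := by
        rw [hm]; have := hp.two_le; nlinarith
      have hp1 : (1 : ℝ) ≤ p := by exact_mod_cast hp.one_lt.le
      rcases ih m hmn hm1 (hs.of_dvd ⟨p, by rw [hm, mul_comm]⟩) with
        h | ⟨a, b, c, k, e, ha, hab, hc, hby, hyab, hyk, harc⟩
      · rcases le_or_gt ((p : ℝ) * m) y with h2 | h2
        · left; rw [hm]; push_cast; exact h2
        · right
          rcases le_total p m with h3 | h3
          · exact ⟨p, m, 1, 0, by rw [hm, mul_one], hp.one_lt.le, h3, le_rfl, h, h2, by simp,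
              by rw [hf1]; exact inArc_one _ _⟩
          · exact ⟨m, p, 1, 0, by rw [hm, mul_one, mul_comm], hm1, h3, le_rfl, hpy, by linarith,
              by simp, by rw [hf1]; exact inArc_one _ _⟩
      · right
        have ha1 : (1 : ℝ) ≤ a := by exact_mod_cast ha
        have hab' : (a : ℝ) ≤ b := by exact_mod_cast hab
        rcases le_or_gt ((a : ℝ) * p) y with h2 | h2
        · have hb' : y < ((a * p : ℕ) : ℝ) * b := by push_cast; nlinarith
          have h2' : ((a * p : ℕ) : ℝ) ≤ y := by push_cast; exact h2
          have hap : 1 ≤ a * p := Nat.mul_pos ha hp.pos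
          rcases le_total (a * p) b with h3 | h3
          · exact ⟨a * p, b, c, k, by rw [hm, e]; ring, hap, h3, hc, hby, hb', hyk, harc⟩
          · exact ⟨b, a * p, c, k, by rw [hm, e]; ring, ha.trans hab, h3, hc, h2',
              by linarith, hyk, harc⟩
        · have hbc : InArc d ((k + 1) * J) (f (b * c)) := by
            rw [hf]
            exact ((hJ b (ha.trans hab) hby).mul harc).mono (by rw [add_mul, one_mul, add_comm])
          have hbc2 : y ^ (k + 1) ≤ ((b * c : ℕ) : ℝ) ^ 2 := by
            push_cast
            rw [mul_pow, pow_succ, mul_comm]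
            refine mul_le_mul ?_ hyk (by positivity) (by positivity)
            nlinarith
          have hbc1 : 1 ≤ b * c := Nat.mul_pos (ha.trans hab) hc
          rcases le_total a p with h3 | h3
          · exact ⟨a, p, b * c, k + 1, by rw [hm, e]; ring, ha, h3, hbc1, hpy, h2, hbc2, hbc⟩
          · exact ⟨p, a, b * c, k + 1, by rw [hm, e]; ring, hp.one_lt.le, h3, hbc1,
              hab'.trans hby, by linarith, hbc2, hbc⟩
  rcases key n hn hs with h | ⟨a, b, c, k, e, ha, hab, hc, hby, hyab, hyk, harc⟩
  · exact ⟨1, by rw [one_mul]; exact hJ n hn h, Or.inl le_rfl⟩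
  · have hab' : (a : ℝ) ≤ b := by exact_mod_cast hab
    refine ⟨k + 2, ?_, Or.inr ?_⟩
    · rw [e, hf, hf]
      exact (((hJ a ha (hab'.trans hby)).mul (hJ b (ha.trans hab) hby)).mul harc).mono
        (le_of_eq (by ring))
    · rw [e]
      push_cast
      have hc' : (1 : ℝ) ≤ c := by exact_mod_cast hc
      calc y ^ (k + 2) = y ^ k * y ^ 2 := pow_add y k 2
        _ ≤ (c : ℝ) ^ 2 * y ^ 2 := by gcongr
        _ < (c : ℝ) ^ 2 * ((a : ℝ) * b) ^ 2 := by gcongr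
        _ = _ := by ring

/-- Splitting off a divisor in a prescribed short range by a greedy choice. -/
theorem exists_dvd_le_sqrt {R : ℝ} {m n : ℕ} (hy : 1 ≤ y) (hR2 : R ^ 2 ≤ Real.sqrt y)
    (hny : y < n) (hnR : (n : ℝ) ≤ y * R) (hm : 0 < m) (hms : IsSmooth (Real.sqrt y) m)
    (hmn : (n : ℝ) / y ≤ m) :
    ∃ b : ℕ, b ∣ m ∧ (n : ℝ) / y ≤ b ∧ (b : ℝ) ≤ Real.sqrt y := by
  classical
  have hy0 : 0 < y := by linarith
  have hB1 : 1 < (n : ℝ) / y := by rw [lt_div_iff₀ hy0]; linarith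
  have hBR : (n : ℝ) / y ≤ R := by rw [div_le_iff₀ hy0]; linarith
  have hex : ∃ b : ℕ, b ∣ m ∧ (n : ℝ) / y ≤ b := ⟨m, dvd_rfl, hmn⟩
  obtain ⟨hbm, hbB⟩ := Nat.find_spec hex
  set b := Nat.find hex with hb
  refine ⟨b, hbm, hbB, ?_⟩
  have hb1 : b ≠ 1 := by
    intro h
    rw [h] at hbB
    norm_num at hbB
    linarith
  have hp := Nat.minFac_prime hb1
  obtain ⟨e, he⟩ := Nat.minFac_dvd b
  set p := b.minFac
  have hpm : p ∣ m := (Dvd.intro e he.symm).trans hbm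
  rcases le_or_gt ((n : ℝ) / y) p with h | h
  · have : b ≤ p := Nat.find_min' hex ⟨hpm, h⟩
    exact (Nat.cast_le.2 this).trans (hms p hp hpm)
  · have hb0 : 0 < b := Nat.pos_of_dvd_of_pos hbm hm
    have heb : e < b := by
      have h2 := hp.two_le
      have he0 : 0 < e := by
        rcases Nat.eq_zero_or_pos e with h' | h'
        · subst h'; omega
        · exact h'
      rw [he]; nlinarith
    have hmin := Nat.find_min hex heb
    have hem : e ∣ m := (Dvd.intro_left p he.symm).trans hbm
    have heB : (e : ℝ) < (n : ℝ) / y := by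
      by_contra hc
      exact hmin ⟨hem, not_lt.1 hc⟩
    rw [he]
    push_cast
    have hp0 : (0 : ℝ) ≤ p := Nat.cast_nonneg p
    have he0 : (0 : ℝ) ≤ e := Nat.cast_nonneg e
    nlinarith

/-- Most integers slightly larger than `y` factor as `a * b` with `a ≤ y` and `b ≤ √y`; the second
factor contributes only half of the arc. -/
theorem inArc_of_forall_not_mul_dvd {x R : ℝ} (hf : ∀ a b, f (a * b) = f a * f b) (hy : 1 ≤ y)
    (hR1 : 1 ≤ R) (hR2 : R ^ 2 ≤ Real.sqrt y) (hxR : x ≤ y * R)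
    (hJ : ∀ n : ℕ, 1 ≤ n → (n : ℝ) ≤ y → InArc d J (f n))
    (hJ2 : ∀ n : ℕ, 1 ≤ n → (n : ℝ) ≤ Real.sqrt y → InArc d (J / 2) (f n))
    {n : ℕ} (hn : 1 ≤ n) (hnx : (n : ℝ) ≤ x) (hs : IsSmooth y n)
    (hbad : ¬∃ p p' : ℕ, p.Prime ∧ p'.Prime ∧ Real.sqrt y < p ∧ (p : ℝ) ≤ Real.sqrt x ∧
      Real.sqrt y < p' ∧ (p' : ℝ) ≤ x / Real.sqrt y ∧ p * p' ∣ n) :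
    InArc d (J + J / 2) (f n) := by
  have hy0 : 0 < y := by linarith
  have hsq0 : 0 < Real.sqrt y := Real.sqrt_pos.2 hy0
  rcases le_or_gt (n : ℝ) y with hny | hny
  · exact (hJ n hn hny).mono (Nat.le_add_right _ _)
  have hnR : (n : ℝ) ≤ y * R := hnx.trans hxR
  have hBR : (n : ℝ) / y ≤ R := by rw [div_le_iff₀ hy0]; linarith
  -- once a divisor `b` with `n / y ≤ b ≤ √y` is available, write `n = (n / b) * b`
  have hfin : ∀ b : ℕ, b ∣ n → (n : ℝ) / y ≤ b → (b : ℝ) ≤ Real.sqrt y →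
      InArc d (J + J / 2) (f n) := by
    rintro b ⟨a, ha⟩ h1 h2
    have hb0 : 0 < b := Nat.pos_of_dvd_of_pos ⟨a, ha⟩ hn
    have ha0 : 0 < a := Nat.pos_of_dvd_of_pos (Dvd.intro_left b ha.symm) hn
    have hay : (a : ℝ) ≤ y := by
      have hb0' : (0 : ℝ) < b := by exact_mod_cast hb0
      rw [div_le_iff₀ hy0, ha] at h1
      push_cast at h1
      exact le_of_mul_le_mul_left h1 hb0'
    rw [ha, hf, mul_comm]
    exact (hJ a ha0 hay).mul (hJ2 b hb0 h2)
  by_cases hsm : IsSmooth (Real.sqrt y) n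
  · obtain ⟨b, hb1, hb2, hb3⟩ := exists_dvd_le_sqrt hy hR2 hny hnR hn hsm
      (div_le_self (Nat.cast_nonneg n) hy)
    exact hfin b hb1 hb2 hb3
  rw [IsSmooth] at hsm
  push Not at hsm
  obtain ⟨p, hp, ⟨m, hm⟩, hpy⟩ := hsm
  have hm0 : 0 < m := Nat.pos_of_dvd_of_pos (Dvd.intro_left p hm.symm) hn
  have hmn : m ∣ n := Dvd.intro_left p hm.symm
  have hms : IsSmooth (Real.sqrt y) m := by
    intro p' hp' hp'm
    by_contra hc
    rw [not_le] at hc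
    have hpp : p * p' ∣ n := by rw [hm]; exact Nat.mul_dvd_mul_left p hp'm
    have hppx : (p : ℝ) * p' ≤ x := by
      have := Nat.le_of_dvd hn hpp
      have : ((p * p' : ℕ) : ℝ) ≤ n := by exact_mod_cast this
      push_cast at this
      linarith
    have hkey : ∀ a b : ℕ, Real.sqrt y < a → a ≤ b → (a : ℝ) * b ≤ x →
        (a : ℝ) ≤ Real.sqrt x ∧ (b : ℝ) ≤ x / Real.sqrt y := by
      intro a b h1 h2 h3
      have h2' : (a : ℝ) ≤ b := by exact_mod_cast h2
      have ha0 : (0 : ℝ) < a := by linarith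
      refine ⟨Real.le_sqrt_of_sq_le (by nlinarith), ?_⟩
      rw [le_div_iff₀ hsq0]
      nlinarith
    rcases le_total p p' with h | h
    · obtain ⟨h1, h2⟩ := hkey p p' hpy h hppx
      exact hbad ⟨p, p', hp, hp', hpy, h1, hc, h2, hpp⟩
    · obtain ⟨h1, h2⟩ := hkey p' p hc h (by linarith)
      exact hbad ⟨p', p, hp', hp, hc, h1, hpy, h2, by rwa [mul_comm]⟩
  rcases le_or_gt (m : ℝ) (Real.sqrt y) with h | h
  · rw [hm, hf]
    exact (hJ p hp.one_lt.le (hs p hp ⟨m, hm⟩)).mul (hJ2 m hm0 h)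
  · have hBm : (n : ℝ) / y ≤ m := by nlinarith
    obtain ⟨b, hb1, hb2, hb3⟩ := exists_dvd_le_sqrt hy hR2 hny hnR hm0 hms hBm
    exact hfin b (hb1.trans hmn) hb2 hb3

theorem eq_one_of_isSmooth {t : ℝ} (hf : ∀ a b, f (a * b) = f a * f b) (hf1 : f 1 = 1)
    (h : ∀ p : ℕ, p.Prime → (p : ℝ) ≤ t → f p = 1) {n : ℕ} (hn : 1 ≤ n) (hs : IsSmooth t n) :
    f n = 1 := by
  induction n using Nat.recOnMul with
  | zero => omega
  | one => exact hf1
  | prime p hp => exact h p hp (hs p hp dvd_rfl)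
  | mul a b iha ihb =>
    have ha : 1 ≤ a := Nat.pos_of_ne_zero fun h => by simp [h] at hn
    have hb : 1 ≤ b := Nat.pos_of_ne_zero fun h => by simp [h] at hn
    rw [hf, iha ha (hs.of_dvd (dvd_mul_right a b)), ihb hb (hs.of_dvd (dvd_mul_left b a)), one_mul]

/-- Characters of order `7`: primes up to the cube root of `y` have value `1`, so only integers
with two large prime factors can leave the arc. -/
theorem inArc_seven_two {x t x₃ : ℝ} (hf : ∀ a b, f (a * b) = f a * f b) (hf1 : f 1 = 1)
    (ht0 : 0 < t) (hx₃ : x₃ ^ 3 = x) (hx₃0 : 0 ≤ x₃)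
    (hJ : ∀ n : ℕ, 1 ≤ n → (n : ℝ) ≤ y → InArc 7 2 (f n))
    (ht : ∀ p : ℕ, p.Prime → (p : ℝ) ≤ t → f p = 1)
    {n : ℕ} (hn : 1 ≤ n) (hnx : (n : ℝ) ≤ x) (hs : IsSmooth y n)
    (hbad₁ : ¬∃ p : ℕ, p.Prime ∧ t < p ∧ (p : ℝ) ≤ x₃ ∧ p ∣ n)
    (hbad₂ : ¬∃ p p' : ℕ, p.Prime ∧ p'.Prime ∧ t < p ∧ (p : ℝ) ≤ Real.sqrt x ∧
      Real.sqrt y < p' ∧ (p' : ℝ) ≤ x / t ∧ p * p' ∣ n) :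
    InArc 7 2 (f n) := by
  have hns : ∀ m : ℕ, ¬IsSmooth t m → ∃ p : ℕ, p.Prime ∧ t < p ∧ ∃ k, m = p * k := by
    intro m h
    rw [IsSmooth] at h
    push Not at h
    obtain ⟨p, hp, hpm, hpt⟩ := h
    exact ⟨p, hp, hpt, hpm⟩
  have hone : ∀ m : ℕ, m ∣ n → IsSmooth t m → f m = 1 := fun m hm h =>
    eq_one_of_isSmooth hf hf1 ht (Nat.pos_of_dvd_of_pos hm hn) h
  by_cases h0 : IsSmooth t n
  · rw [hone n dvd_rfl h0]; exact inArc_one _ _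
  obtain ⟨p, hp, hpt, m, hm⟩ := hns n h0
  by_cases h1 : IsSmooth t m
  · rw [hm, hf, hone m (Dvd.intro_left p hm.symm) h1, mul_one]
    exact hJ p hp.one_lt.le (hs p hp ⟨m, hm⟩)
  obtain ⟨p', hp', hpt', k, hk⟩ := hns m h1
  have hn2 : n = p * p' * k := by rw [hm, hk]; ring
  have hle : ∀ a : ℕ, a ∣ n → (a : ℝ) ≤ x := fun a ha =>
    (Nat.cast_le.2 (Nat.le_of_dvd hn ha)).trans hnx
  by_cases h2 : IsSmooth t k
  · rw [hn2, hf, hone k (Dvd.intro_left _ hn2.symm) h2, mul_one]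
    rcases le_or_gt ((p * p' : ℕ) : ℝ) y with h3 | h3
    · exact hJ _ (Nat.mul_pos hp.pos hp'.pos) h3
    · exfalso
      have hdvd : p * p' ∣ n := ⟨k, hn2⟩
      have hx := hle _ hdvd
      push_cast at h3 hx
      have hkey : ∀ a b : ℕ, t < a → a ≤ b → y < (a : ℝ) * b → (a : ℝ) * b ≤ x →
          (a : ℝ) ≤ Real.sqrt x ∧ Real.sqrt y < b ∧ (b : ℝ) ≤ x / t := by
        intro a b h1 h2 h3 h4
        have h2' : (a : ℝ) ≤ b := by exact_mod_cast h2
        have ha0 : (0 : ℝ) < a := by linarith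
        refine ⟨Real.le_sqrt_of_sq_le (by nlinarith), ?_, ?_⟩
        · rw [Real.sqrt_lt' (by linarith)]; nlinarith
        · rw [le_div_iff₀ ht0]; nlinarith
      rcases le_total p p' with h | h
      · obtain ⟨h1, h2, h3⟩ := hkey p p' hpt h h3 hx
        exact hbad₂ ⟨p, p', hp, hp', hpt, h1, h2, h3, hdvd⟩
      · obtain ⟨h1, h2, h3⟩ := hkey p' p hpt' h (by linarith) (by linarith)
        exact hbad₂ ⟨p', p, hp', hp, hpt', h1, h2, h3, by rwa [mul_comm]⟩
  · exfalso
    obtain ⟨p'', hp'', hpt'', l, hl⟩ := hns k h2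
    have hn3 : n = p * p' * p'' * l := by rw [hn2, hl]; ring
    have hdvd : p * p' * p'' ∣ n := ⟨l, hn3⟩
    have hx := hle _ hdvd
    push_cast at hx
    -- the smallest of three large prime factors is at most the cube root of `x`
    have hlt : ∀ a : ℕ, a.Prime → t < a → a ∣ n → x₃ < a := fun a ha h1 h2 => by
      by_contra hc
      exact hbad₁ ⟨a, ha, h1, not_lt.1 hc, h2⟩
    have a1 := hlt p hp hpt ⟨p' * p'' * l, by rw [hn3]; ring⟩
    have a2 := hlt p' hp' hpt' ⟨p * p'' * l, by rw [hn3]; ring⟩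
    have a3 := hlt p'' hp'' hpt'' ⟨p * p' * l, by rw [hn3]; ring⟩
    have a4 : x₃ * x₃ < (p : ℝ) * p' := mul_lt_mul'' a1 a2 hx₃0 hx₃0
    have a5 : x₃ * x₃ * x₃ < (p : ℝ) * p' * p'' := mul_lt_mul'' a4 a3 (by positivity) hx₃0
    rw [← hx₃] at hx
    linarith [show x₃ ^ 3 = x₃ * x₃ * x₃ by ring]

end

/-! ### Numerical inequalities -/

/-- The upper bound for `ρ` on `[2, 3]` as a rational function and `log 2`. -/
theorem dickmanRho_le_of_le {A u : ℝ} (h2 : 2 ≤ A) (h3 : A ≤ 3) (hAu : A ≤ u) :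
    dickmanRho u ≤ A - 1 - Real.log 2 - 6 * (A - 2) / (A + 2) := by
  have h4 := dickmanRho_le_of_mem_Icc_two_three h2 h3
  have h5 := two_mul_sub_div_add_le_log (show 1 ≤ A / 2 by linarith)
  rw [Real.log_div (by linarith) (by norm_num)] at h5
  have h6 : 2 * (A / 2 - 1) / (A / 2 + 1) = 2 * (A - 2) / (A + 2) := by
    have : A + 2 ≠ 0 := by linarith
    have : A / 2 + 1 ≠ 0 := by linarith
    field_simp
  have h7 : 6 * (A - 2) / (A + 2) = 3 * (2 * (A - 2) / (A + 2)) := by ring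
  rw [h6] at h5
  have := dickmanRho_antitone hAu
  linarith

theorem log_le_of_le {a B : ℝ} (ha : 1 ≤ a) (haB : a ≤ B) : Real.log a ≤ (B - B⁻¹) / 2 :=
  (Real.log_le_log (by linarith) haB).trans (log_le_half_sub_inv (ha.trans haB))

theorem five_mul_dickmanRho_add_lt {u : ℝ} (h1 : 2.45 ≤ u) (h2 : u ≤ 3) :
    5 * dickmanRho u + 0.003 < 1 - Real.log (u / 2) := by
  have hl := Real.log_two_gt_d9
  have key : ∀ A B : ℝ, 2 ≤ A → A ≤ 3 → A ≤ u → u ≤ B →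
      5 * (A - 1 - 0.6931471803 - 6 * (A - 2) / (A + 2)) + 0.003 <
        1 - (B / 2 - (B / 2)⁻¹) / 2 → 5 * dickmanRho u + 0.003 < 1 - Real.log (u / 2) := by
    intro A B hA hA3 hAu huB h
    have h3 := dickmanRho_le_of_le hA hA3 hAu
    have h4 := log_le_of_le (show 1 ≤ u / 2 by linarith) (show u / 2 ≤ B / 2 by linarith)
    linarith
  rcases le_total u 2.5 with h | h
  · exact key 2.45 2.5 (by norm_num) (by norm_num) h1 h (by norm_num)
  rcases le_total u 2.6 with h' | h'
  · exact key 2.5 2.6 (by norm_num) (by norm_num) h h' (by norm_num)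
  rcases le_total u 2.8 with h'' | h''
  · exact key 2.6 2.8 (by norm_num) (by norm_num) h' h'' (by norm_num)
  · exact key 2.8 3 (by norm_num) (by norm_num) h'' h2 (by norm_num)

/-- For `2 ≤ u ≤ 2.45` the arc of `j` with `|j| ≤ J + ⌊J/2⌋`, `J < d ρ(u)`, has density smaller than
that of the integers constrained to it, unless `d = 7` and `J = 2`. For large `d` this is a matter
of `3 ρ(u)`; for small `d` the integrality of `J` is needed. -/
theorem arc_density_lt {u : ℝ} (h1 : 2 ≤ u) (h2 : u ≤ 2.45) {d J : ℕ} (hd : 1 < d * dickmanRho u)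
    (hJ : (J : ℝ) < d * dickmanRho u) (hdJ : ¬(d = 7 ∧ J = 2)) :
    (2 * ((J + J / 2 : ℕ) : ℝ) + 1) / d + Real.log (u / 2) +
      Real.log (u / 2) * Real.log (u - 1) + 0.01 < 1 := by
  have hl := Real.log_two_gt_d9
  have hd0 : (0 : ℝ) < d := by
    rcases Nat.eq_zero_or_pos d with h | h
    · subst h; norm_num at hd
    · exact_mod_cast h
  have key : ∀ (A B : ℝ) (r b : ℕ), 2 ≤ A → A ≤ 3 → A ≤ u → u ≤ B →
      A - 1 - 0.6931471803 - 6 * (A - 2) / (A + 2) ≤ (r : ℝ) / 100000 →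
      (b : ℝ) / 1000 + (B / 2 - (B / 2)⁻¹) / 2 +
        (B / 2 - (B / 2)⁻¹) / 2 * (((B - 1) - (B - 1)⁻¹) / 2) + 0.01 < 1 →
      (100000 < d * r → J * 100000 < d * r → 1000 * (2 * (J + J / 2) + 1) ≤ b * d) →
      (2 * ((J + J / 2 : ℕ) : ℝ) + 1) / d + Real.log (u / 2) +
        Real.log (u / 2) * Real.log (u - 1) + 0.01 < 1 := by
    intro A B r b hA hA3 hAu huB hr hb hnat
    have h3 := dickmanRho_le_of_le hA hA3 hAu
    have h4 := log_le_of_le (show 1 ≤ u / 2 by linarith) (show u / 2 ≤ B / 2 by linarith)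
    have h5 := log_le_of_le (show 1 ≤ u - 1 by linarith) (show u - 1 ≤ B - 1 by linarith)
    have h6 : 0 ≤ Real.log (u / 2) := Real.log_nonneg (by linarith)
    have h7 : 0 ≤ Real.log (u - 1) := Real.log_nonneg (by linarith)
    have h8 := mul_le_mul h4 h5 h7 (h6.trans h4)
    have h9 : (d : ℝ) * dickmanRho u ≤ d * ((r : ℝ) / 100000) :=
      mul_le_mul_of_nonneg_left (by linarith) hd0.le
    have n1 : 100000 < d * r := by
      have : (100000 : ℝ) < d * r := by linarith
      exact_mod_cast this
    have n2 : J * 100000 < d * r := by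
      have : (J : ℝ) * 100000 < d * r := by linarith
      exact_mod_cast this
    have n3 : (1000 : ℝ) * (2 * ((J + J / 2 : ℕ) : ℝ) + 1) ≤ b * d := by
      exact_mod_cast hnat n1 n2
    have h10 : (2 * ((J + J / 2 : ℕ) : ℝ) + 1) / d ≤ b / 1000 := by
      rw [div_le_iff₀ hd0]; linarith
    linarith
  -- on each interval `[A, B]`, `r / 100000` bounds `ρ(A)`, and `b / 1000` the admissible density;
  -- the remaining inequality between integers holds for large `d` by linearity
  rcases le_total u 2.04 with h | h
  · refine key 2 2.04 30686 965 (by norm_num) (by norm_num) h1 h (by norm_num) (by norm_num)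
      fun n1 n2 => ?_
    rcases Nat.lt_or_ge d 23 with h' | h'
    · interval_cases d <;> omega
    · omega
  rcases le_total u 2.1 with h' | h'
  · refine key 2.04 2.1 28746 934 (by norm_num) (by norm_num) h h' (by norm_num) (by norm_num)
      fun n1 n2 => ?_
    rcases Nat.lt_or_ge d 14 with h'' | h''
    · interval_cases d <;> omega
    · omega
  rcases le_total u 2.15 with h'' | h''
  · refine key 2.1 2.15 26065 900 (by norm_num) (by norm_num) h' h'' (by norm_num) (by norm_num)
      fun n1 n2 => ?_
    rcases Nat.lt_or_ge d 9 with h3 | h3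
    · interval_cases d <;> omega
    · omega
  rcases le_total u 2.3 with h3 | h3
  · refine key 2.15 2.3 24050 810 (by norm_num) (by norm_num) h'' h3 (by norm_num) (by norm_num)
      fun n1 n2 => ?_
    rcases Nat.lt_or_ge d 12 with h4 | h4
    · interval_cases d <;> omega
    · omega
  · refine key 2.3 2.45 18900 700 (by norm_num) (by norm_num) h3 h2 (by norm_num) (by norm_num)
      fun n1 n2 => ?_
    rcases Nat.lt_or_ge d 8 with h4 | h4
    · interval_cases d <;> omega
    · omega

theorem two_mul_add_one_le_two_rpow {K : ℕ} {w : ℝ} (hw : 3 ≤ w) (hKw : (K : ℝ) < w) :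
    2 * (K : ℝ) + 1 ≤ 7 / 8 * (2 : ℝ) ^ w := by
  have key : ∀ n : ℕ, 8 * (2 * (n + 3) + 1) ≤ 7 * 2 ^ (n + 3) := by
    intro n
    induction n with
    | zero => norm_num
    | succ n ih => rw [show n + 1 + 3 = (n + 3) + 1 by ring, pow_succ]; omega
  rcases Nat.lt_or_ge K 3 with h | h
  · have h1 : (2 : ℝ) ^ (3 : ℝ) ≤ 2 ^ w := Real.rpow_le_rpow_of_exponent_le (by norm_num) hw
    norm_num at h1
    have h2 : (K : ℝ) ≤ 2 := by exact_mod_cast (show K ≤ 2 by omega)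
    linarith
  · have h1 : (2 : ℝ) ^ (K : ℝ) ≤ 2 ^ w := Real.rpow_le_rpow_of_exponent_le (by norm_num) hKw.le
    rw [Real.rpow_natCast] at h1
    obtain ⟨n, rfl⟩ := Nat.exists_eq_add_of_le' h
    have h2 : (8 : ℝ) * (2 * ((n + 3 : ℕ) : ℝ) + 1) ≤ 7 * 2 ^ (n + 3) := by exact_mod_cast key n
    linarith

/-! ### Confinement to a short arc is impossible -/

/-- The hypothetical situation to be refuted: all values `χ n` with `n ≤ y = x^{2/w}` are confined
to the arc of `J < d ρ(u)` steps, where `w` is only slightly larger than `u`, while the values at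
`n ≤ x` are equidistributed up to a small relative error. -/
structure Confined (q : ℕ) (χ : DirichletCharacter ℂ q) (u x y : ℝ) (J : ℕ) : Prop where
  prime : q.Prime
  two_lt : 2 < u
  one_lt_mul : 1 < orderOf χ * dickmanRho u
  lt_mul : (J : ℝ) < orderOf χ * dickmanRho u
  y_pos : 0 < y
  le_log : 20000 ≤ Real.log y
  x_pos : 0 < x
  x_lt : x < q
  le_w : u ≤ 2 * (Real.log x / Real.log y)
  w_sub_le : 4 * u * (2 * (Real.log x / Real.log y) - u) ≤ 0.001
  log_le : 64 * Real.log x ≤ Real.log y ^ 2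
  error_le : Real.sqrt q * (1 + Real.log q) ^ 2 ≤ 0.0005 * dickmanRho u * ⌊x⌋₊
  inArc : ∀ n : ℕ, 1 ≤ n → (n : ℝ) ≤ y → InArc (orderOf χ) J (χ (n : ZMod q))

namespace Confined

variable {q : ℕ} {χ : DirichletCharacter ℂ q} {u x y : ℝ} {J : ℕ}

theorem log_pos (h : Confined q χ u x y J) : 0 < Real.log y := by linarith [h.le_log]

theorem lt_y (h : Confined q χ u x y J) : 20000 < y := by
  linarith [h.le_log, Real.log_le_sub_one_of_pos h.y_pos]

theorem two_mul_log_x (h : Confined q χ u x y J) :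
    2 * (Real.log x / Real.log y) * Real.log y = 2 * Real.log x := by
  have := h.log_pos
  field_simp

theorem log_y_le (h : Confined q χ u x y J) : Real.log y ≤ Real.log x := by
  nlinarith [h.two_mul_log_x, h.le_w, h.two_lt, h.log_pos]

theorem y_le_x (h : Confined q χ u x y J) : y ≤ x :=
  (Real.log_le_log_iff h.y_pos h.x_pos).1 h.log_y_le

theorem floor_pos (h : Confined q χ u x y J) : (0 : ℝ) < ⌊x⌋₊ := by
  have : 1 ≤ ⌊x⌋₊ := Nat.one_le_floor_iff _ |>.2 (by linarith [h.y_le_x, h.lt_y])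
  exact_mod_cast this

theorem order_pos (h : Confined q χ u x y J) : (0 : ℝ) < orderOf χ := by
  have := Fact.mk h.prime
  exact_mod_cast MulChar.orderOf_pos χ

theorem w_sub_le' (h : Confined q χ u x y J) : 2 * (Real.log x / Real.log y) - u ≤ 0.000125 := by
  nlinarith [h.two_lt, h.le_w, h.w_sub_le]

theorem map_mul (χ : DirichletCharacter ℂ q) (a b : ℕ) :
    χ ((a * b : ℕ) : ZMod q) = χ (a : ZMod q) * χ (b : ZMod q) := by
  rw [Nat.cast_mul, _root_.map_mul]

theorem map_one (χ : DirichletCharacter ℂ q) : χ ((1 : ℕ) : ZMod q) = 1 := by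
  rw [Nat.cast_one, _root_.map_one]

theorem rho_le (h : Confined q χ u x y J) : dickmanRho u < 0.307 := by
  have h1 := dickmanRho_antitone h.two_lt.le
  rw [dickmanRho_eq_one_sub_log one_le_two le_rfl] at h1
  linarith [Real.log_two_gt_d9]

theorem three_mul_lt (h : Confined q χ u x y J) : 3 * J < orderOf χ := by
  have h1 := h.lt_mul
  have h2 := mul_lt_mul_of_pos_left h.rho_le h.order_pos
  have : (3 : ℝ) * J < orderOf χ := by linarith [h.order_pos]
  exact_mod_cast this

theorem log_half_w_le (h : Confined q χ u x y J) :
    Real.log (Real.log x / Real.log y) ≤ Real.log (u / 2) + 0.001 := by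
  have hu := h.two_lt
  have hl := h.w_sub_le'
  set v := Real.log x / Real.log y
  have h1 : v ≤ u / 2 * (1 + 0.001) := by nlinarith
  have hv : 0 < v := by linarith [h.le_w]
  refine (Real.log_le_log hv h1).trans ?_
  rw [Real.log_mul (by linarith) (by norm_num)]
  have := Real.log_le_sub_one_of_pos (show (0 : ℝ) < 1 + 0.001 by norm_num)
  linarith

open Classical in
/-- Equidistribution: a set of integers up to `x` with values in the arc of `M` steps has relative
density at most `(2M + 1)/d` up to a small error. -/
theorem card_le (h : Confined q χ u x y J) {M : ℕ} {S : Finset ℕ} (hS : S ⊆ Finset.Icc 1 ⌊x⌋₊)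
    (hM : ∀ n ∈ S, InArc (orderOf χ) M (χ (n : ZMod q))) :
    (S.card : ℝ) ≤ ⌊x⌋₊ * ((2 * M + 1) / (orderOf χ : ℝ) + 0.0005 * dickmanRho u) := by
  have hX : ⌊x⌋₊ < q := (Nat.floor_lt h.x_pos.le).2 h.x_lt
  have h1 := card_inArc_le h.prime χ hX M
  have h2 : S ⊆ (Finset.Icc 1 ⌊x⌋₊).filter fun n : ℕ => InArc (orderOf χ) M (χ (n : ZMod q)) :=
    fun n hn => Finset.mem_filter.2 ⟨hS hn, hM n hn⟩
  have h3 : (S.card : ℝ) ≤ _ := (Nat.cast_le.2 (Finset.card_le_card h2)).trans h1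
  have := h.error_le
  linarith

/-- For `w ≤ K + 1` smooth integers up to `x` have at most `K` factors, hence lie in the arc of
`K J` steps. -/
theorem smoothCount_le (h : Confined q χ u x y J) {K : ℕ} (hK1 : 1 ≤ K)
    (hK : 2 * (Real.log x / Real.log y) ≤ K + 1) :
    (smoothCount x y : ℝ) ≤ ⌊x⌋₊ * ((2 * K + 1.0005) * dickmanRho u) := by
  classical
  have h1 : (smoothCount x y : ℝ) ≤ _ := h.card_le (M := K * J) (Finset.filter_subset _ _)
    (fun n hn => by
      obtain ⟨hn1, hn2⟩ := Finset.mem_filter.1 hn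
      rw [Finset.mem_Icc] at hn1
      obtain ⟨k, hk, hk2⟩ := exists_inArc_of_isSmooth (f := fun n : ℕ => χ (n : ZMod q))
        (map_mul χ) (by linarith [h.lt_y]) h.inArc (map_one χ) hn1.1 hn2
      have hkK : k ≤ K := by
        rcases hk2 with hk2 | hk2
        · omega
        · have hnx : (n : ℝ) ≤ x := (Nat.le_floor_iff h.x_pos.le).1 hn1.2
          have hn0 : (0 : ℝ) < n := by exact_mod_cast hn1.1
          have h3 : y ^ k < x ^ 2 := hk2.trans_le (by gcongr)
          have h4 := Real.log_lt_log (pow_pos h.y_pos k) h3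
          rw [Real.log_pow, Real.log_pow] at h4
          push_cast at h4
          have h5 := h.two_mul_log_x
          have h6 : (k : ℝ) < K + 1 := by
            by_contra hc
            nlinarith [h.log_pos]
          have : k < K + 1 := by exact_mod_cast h6
          omega
      exact hk.mono (Nat.mul_le_mul_right J hkK))
  refine h1.trans (mul_le_mul_of_nonneg_left ?_ (Nat.cast_nonneg _))
  have h2 : (2 * ((K * J : ℕ) : ℝ) + 1) / (orderOf χ : ℝ) ≤ (2 * K + 1) * dickmanRho u := by
    rw [div_le_iff₀ h.order_pos]
    push_cast
    have := mul_le_mul_of_nonneg_left h.lt_mul.le (Nat.cast_nonneg (α := ℝ) K)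
    linarith [h.one_lt_mul]
  linarith

/-- For `w ≥ 3` the density `0.9 · 2^w ρ(w)` of the smooth integers exceeds that of the arc which
contains their values, of about `(2 ⌈w⌉ - 1) ρ(u)`. -/
theorem w_lt_three (h : Confined q χ u x y J) : 2 * (Real.log x / Real.log y) < 3 := by
  by_contra hw
  rw [not_lt] at hw
  have hlow := smoothMinorant_mul_le_smoothCount h.y_pos (by linarith [h.le_log]) h.y_le_x h.log_le
  have hcmp := mul_dickmanRho_le_of_le h.two_lt.le h.le_w
  have hsub := h.w_sub_le
  have hw1 := Nat.ceil_lt_add_one (show 0 ≤ 2 * (Real.log x / Real.log y) by linarith)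
  have hw2 := Nat.le_ceil (2 * (Real.log x / Real.log y))
  set w := 2 * (Real.log x / Real.log y) with hwdef
  have hc3 : 3 ≤ ⌈w⌉₊ := by
    have : (3 : ℝ) ≤ ⌈w⌉₊ := by linarith
    exact_mod_cast this
  obtain ⟨K, hK⟩ := Nat.exists_eq_add_of_le' (show 1 ≤ ⌈w⌉₊ by omega)
  rw [hK] at hw1 hw2
  push_cast at hw1 hw2
  have hup := h.smoothCount_le (K := K) (by omega) hw2
  have h2K := two_mul_add_one_le_two_rpow hw (show (K : ℝ) < w by linarith)
  rw [max_eq_left hw, smoothMinorant] at hlow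
  have hfl : (⌊x⌋₊ : ℝ) ≤ x := Nat.floor_le h.x_pos.le
  have hp := dickmanRho_pos u
  have h28 : (8 : ℝ) ≤ 2 ^ w := by
    have := Real.rpow_le_rpow_of_exponent_le (show (1 : ℝ) ≤ 2 by norm_num) hw
    norm_num at this
    exact this
  set P := (2 : ℝ) ^ w
  have h3 : 0.999 * dickmanRho u ≤ dickmanRho w := by nlinarith
  have h4 : (9 / 10 * (P * dickmanRho w)) * x ≤ (2 * K + 1.0005) * dickmanRho u * x := by
    refine hlow.trans (hup.trans ?_)
    rw [mul_comm]
    exact mul_le_mul_of_nonneg_left hfl (by positivity)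
  have h5 := le_of_mul_le_mul_right h4 h.x_pos
  have h6 : P * (0.999 * dickmanRho u) ≤ P * dickmanRho w :=
    mul_le_mul_of_nonneg_left h3 (by linarith)
  have h7 : (2 * K + 1.0005) * dickmanRho u ≤ (7 / 8 * P + 0.0005) * dickmanRho u :=
    mul_le_mul_of_nonneg_right (by linarith) hp.le
  have h8 : 8 * dickmanRho u ≤ P * dickmanRho u := mul_le_mul_of_nonneg_right h28 hp.le
  linarith

/-- Mertens' estimate for the primes in `(A, B]`, for `A`, `B` given on the scale of `y`. -/
theorem primeRecipSum_le' (h : Confined q χ u x y J) {A B : ℝ}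
    (hA : 1 / 3 * Real.log y ≤ Real.log A) (hA0 : 0 < A) (hB0 : 0 < B)
    (hAB : Real.log A ≤ Real.log B) :
    primeRecipSum A B ≤ Real.log (Real.log B / Real.log A) + 0.0012 := by
  have hl := h.le_log
  have hA1 := Real.log_le_sub_one_of_pos hA0
  have hAB' : A ≤ B := (Real.log_le_log_iff hA0 hB0).1 hAB
  refine (primeRecipSum_le (by linarith) hAB').trans ?_
  have : 8 / Real.log A ≤ 0.0012 := by
    rw [div_le_iff₀ (by linarith)]; linarith
  linarith

theorem primeRecipSum_y_x_le (h : Confined q χ u x y J) :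
    primeRecipSum y x ≤ Real.log (u / 2) + 0.0022 := by
  have h1 := h.primeRecipSum_le' (A := y) (B := x) (by linarith [h.log_pos]) h.y_pos h.x_pos
    h.log_y_le
  linarith [h.log_half_w_le]

/-- The decomposition of smooth integers into two factors excludes `u ≥ 2.45`. -/
theorem u_lt (h : Confined q χ u x y J) : u < 2.45 := by
  by_contra hu
  rw [not_lt] at hu
  have hw3 := h.w_lt_three
  have hup := h.smoothCount_le (K := 2) (by norm_num) (by push_cast; linarith)
  have hlow := (floor_mul_one_sub_le_smoothCount (x := x) h.y_pos.le).trans hup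
  have h1 := le_of_mul_le_mul_left hlow h.floor_pos
  have h2 := five_mul_dickmanRho_add_lt hu (by linarith [h.le_w])
  have h3 := h.primeRecipSum_y_x_le
  push_cast at h1
  linarith [h.rho_le]

open Classical in
/-- If all but `σ ⌊x⌋` of the smooth integers up to `x` have their values in the arc of `M` steps,
then equidistribution bounds the size of the arc from below. -/
theorem one_sub_le (h : Confined q χ u x y J) {M : ℕ} {σ : ℝ} (Bad : ℕ → Prop)
    [DecidablePred Bad]
    (hbad : (((Finset.Icc 1 ⌊x⌋₊).filter Bad).card : ℝ) ≤ ⌊x⌋₊ * σ)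
    (hM : ∀ n : ℕ, 1 ≤ n → (n : ℝ) ≤ x → IsSmooth y n → ¬Bad n →
      InArc (orderOf χ) M (χ (n : ZMod q))) :
    1 - primeRecipSum y x - σ ≤ (2 * M + 1) / (orderOf χ : ℝ) + 0.0005 * dickmanRho u := by
  have h1 := floor_mul_one_sub_le_smoothCount (x := x) h.y_pos.le
  have h2 := h.card_le (M := M)
    (S := ((Finset.Icc 1 ⌊x⌋₊).filter (IsSmooth y)).filter fun n => ¬Bad n)
    ((Finset.filter_subset _ _).trans (Finset.filter_subset _ _)) (fun n hn => by
      obtain ⟨hn1, hn2⟩ := Finset.mem_filter.1 hn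
      obtain ⟨hn3, hn4⟩ := Finset.mem_filter.1 hn1
      rw [Finset.mem_Icc] at hn3
      exact hM n hn3.1 ((Nat.le_floor_iff h.x_pos.le).1 hn3.2) hn4 hn2)
  have h3 := Finset.card_filter_add_card_filter_not
    (s := (Finset.Icc 1 ⌊x⌋₊).filter (IsSmooth y)) Bad
  have h4 : (((Finset.Icc 1 ⌊x⌋₊).filter (IsSmooth y)).filter Bad).card ≤
      ((Finset.Icc 1 ⌊x⌋₊).filter Bad).card :=
    Finset.card_le_card (Finset.filter_subset_filter _ (Finset.filter_subset _ _))
  have h5 : (smoothCount x y : ℝ) ≤ ((Finset.Icc 1 ⌊x⌋₊).filter Bad).card +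
      (((Finset.Icc 1 ⌊x⌋₊).filter (IsSmooth y)).filter fun n => ¬Bad n).card := by
    have h6 : smoothCount x y ≤ ((Finset.Icc 1 ⌊x⌋₊).filter Bad).card +
        (((Finset.Icc 1 ⌊x⌋₊).filter (IsSmooth y)).filter fun n => ¬Bad n).card := by
      unfold smoothCount
      omega
    exact_mod_cast h6
  refine le_of_mul_le_mul_left ?_ h.floor_pos
  linarith

theorem inArc_half (h : Confined q χ u x y J) {n : ℕ} (hn : 1 ≤ n) (hny : (n : ℝ) ≤ Real.sqrt y) :
    InArc (orderOf χ) (J / 2) (χ (n : ZMod q)) := by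
  have hn1 : (1 : ℝ) ≤ n := by exact_mod_cast hn
  have hsq : (n : ℝ) ^ 2 ≤ y := (Real.le_sqrt (by linarith) h.y_pos.le).1 hny
  refine (h.inArc n hn (by nlinarith)).half h.three_mul_lt ?_
  have := h.inArc (n ^ 2) (Nat.pos_of_ne_zero (by positivity)) (by push_cast; exact hsq)
  rwa [Nat.cast_pow, map_pow] at this

/-- Halving the arc for one of the two factors excludes everything else but one configuration. -/
theorem order_eq_seven (h : Confined q χ u x y J) : orderOf χ = 7 ∧ J = 2 := by
  classical
  by_contra hdJ
  have hu := h.u_lt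
  have hu2 := h.two_lt
  have hw := h.w_sub_le'
  have hlw := h.log_half_w_le
  have hl := h.log_pos
  have hy1 := h.lt_y
  have hwl := h.two_mul_log_x
  have hyx := h.log_y_le
  have hsq0 : 0 < Real.sqrt y := Real.sqrt_pos.2 h.y_pos
  have hsy : Real.log (Real.sqrt y) = Real.log y / 2 := Real.log_sqrt h.y_pos.le
  have hsx : Real.log (Real.sqrt x) = Real.log x / 2 := Real.log_sqrt h.x_pos.le
  have hxy : Real.log (x / Real.sqrt y) = Real.log x - Real.log y / 2 := by
    rw [Real.log_div h.x_pos.ne' hsq0.ne', hsy]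
  have hR : (x / y) ^ 2 ≤ Real.sqrt y := by
    have hxy0 : 0 < x / y := div_pos h.x_pos h.y_pos
    rw [← Real.log_le_log_iff (by positivity) hsq0, Real.log_pow, hsy,
      Real.log_div h.x_pos.ne' h.y_pos.ne']
    push_cast
    nlinarith
  have hR1 : 1 ≤ x / y := by
    rw [le_div_iff₀ h.y_pos, one_mul]; exact h.y_le_x
  have hbound := h.one_sub_le (M := J + J / 2) _
    (card_exists_prime_mul_dvd_le hsq0.le hsq0.le (Real.sqrt x) (x / Real.sqrt y) ⌊x⌋₊)
    (fun n hn hnx hs hb => inArc_of_forall_not_mul_dvd (f := fun n : ℕ => χ (n : ZMod q))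
      (map_mul χ) (by linarith) hR1 hR (le_of_eq (by field_simp [h.y_pos.ne'])) h.inArc
      (fun n hn hny => h.inArc_half hn hny) hn hnx hs hb)
  have hS1 := h.primeRecipSum_y_x_le
  have hS2 := h.primeRecipSum_le' (A := Real.sqrt y) (B := Real.sqrt x) (by rw [hsy]; linarith) hsq0
    (Real.sqrt_pos.2 h.x_pos) (by rw [hsy, hsx]; linarith)
  have hS3 := h.primeRecipSum_le' (A := Real.sqrt y) (B := x / Real.sqrt y) (by rw [hsy]; linarith)
    hsq0 (div_pos h.x_pos hsq0) (by rw [hsy, hxy]; linarith)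
  rw [hsx, hsy, div_div_div_cancel_right₀ (by norm_num)] at hS2
  rw [hxy, hsy] at hS3
  have e3 : (Real.log x - Real.log y / 2) / (Real.log y / 2) =
      2 * (Real.log x / Real.log y) - 1 := by field_simp
  rw [e3] at hS3
  have hb : Real.log (2 * (Real.log x / Real.log y) - 1) ≤ Real.log (u - 1) + 0.001 := by
    have h1 : 2 * (Real.log x / Real.log y) - 1 ≤ (u - 1) * (1 + 0.001) := by linarith
    refine (Real.log_le_log (by linarith [h.le_w]) h1).trans ?_
    rw [Real.log_mul (by linarith) (by norm_num)]
    have := Real.log_le_sub_one_of_pos (show (0 : ℝ) < 1 + 0.001 by norm_num)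
    linarith
  have hd := arc_density_lt hu2.le hu.le h.one_lt_mul h.lt_mul hdJ
  have ha0 : 0 ≤ Real.log (u / 2) := Real.log_nonneg (by linarith)
  have hb0 : 0 ≤ Real.log (u - 1) := Real.log_nonneg (by linarith)
  have ha1 := Real.log_le_sub_one_of_pos (show 0 < u / 2 by linarith)
  have hb1 := Real.log_le_sub_one_of_pos (show 0 < u - 1 by linarith)
  set a := Real.log (u / 2)
  set b := Real.log (u - 1)
  have hprod : primeRecipSum (Real.sqrt y) (Real.sqrt x) *
      primeRecipSum (Real.sqrt y) (x / Real.sqrt y) ≤ (a + 0.0022) * (b + 0.0022) :=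
    mul_le_mul (by linarith) (by linarith) (primeRecipSum_nonneg _ _) (by linarith)
  nlinarith [h.rho_le]

theorem u_lt_of_eq_two (h : Confined q χ u x y J) (hd7 : orderOf χ = 7) (hJ2 : J = 2) :
    u < 2.1 := by
  by_contra hc
  rw [not_lt] at hc
  have h1 := dickmanRho_le_of_le (A := 2.1) (by norm_num) (by norm_num) hc
  have h2 := h.lt_mul
  rw [hd7, hJ2] at h2
  push_cast at h2
  norm_num at h1
  linarith [Real.log_two_gt_d9]

/-- The density of the integers excluded in `inArc_seven_two`, with `t` and `x₃` the cube roots of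
`y` and `x`. -/
theorem exceptional_sum_le (h : Confined q χ u x y J) (hu : u < 2.1) {t x₃ : ℝ} (ht0 : 0 < t)
    (hx₃0 : 0 < x₃) (htl : Real.log t = Real.log y / 3) (hx₃l : Real.log x₃ = Real.log x / 3) :
    primeRecipSum t x₃ +
      primeRecipSum t (Real.sqrt x) * primeRecipSum (Real.sqrt y) (x / t) ≤ 0.2246 := by
  have hu2 := h.two_lt
  have hw := h.w_sub_le'
  have hl := h.log_pos
  have hyx := h.log_y_le
  have hwl := h.two_mul_log_x
  have hsq0 : 0 < Real.sqrt y := Real.sqrt_pos.2 h.y_pos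
  have hsy : Real.log (Real.sqrt y) = Real.log y / 2 := Real.log_sqrt h.y_pos.le
  have hsx : Real.log (Real.sqrt x) = Real.log x / 2 := Real.log_sqrt h.x_pos.le
  have hxt : Real.log (x / t) = Real.log x - Real.log y / 3 := by
    rw [Real.log_div h.x_pos.ne' ht0.ne', htl]
  have hlw := h.log_half_w_le
  have hS2 := h.primeRecipSum_le' (A := t) (B := x₃) (by rw [htl]; linarith) ht0
    hx₃0 (by rw [htl, hx₃l]; linarith)
  have hS3 := h.primeRecipSum_le' (A := t) (B := Real.sqrt x) (by rw [htl]; linarith) ht0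
    (Real.sqrt_pos.2 h.x_pos) (by rw [htl, hsx]; linarith)
  have hS4 := h.primeRecipSum_le' (A := Real.sqrt y) (B := x / t) (by rw [hsy]; linarith) hsq0
    (div_pos h.x_pos ht0) (by rw [hsy, hxt]; linarith)
  rw [htl, hx₃l, div_div_div_cancel_right₀ (by norm_num)] at hS2
  have e3 : Real.log (Real.sqrt x) / Real.log t = 3 / 2 * (Real.log x / Real.log y) := by
    rw [htl, hsx]; field_simp
  have e4 : Real.log (x / t) / Real.log (Real.sqrt y) =
      2 * (Real.log x / Real.log y) - 2 / 3 := by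
    rw [hsy, hxt]; field_simp
  rw [e3] at hS3
  rw [e4] at hS4
  have hv := h.le_w
  set v := Real.log x / Real.log y
  have l1 := log_le_of_le (show 1 ≤ u / 2 by linarith) (show u / 2 ≤ 1.05 by linarith)
  have l3 : Real.log (3 / 2 * v) ≤ 0.4631 := by
    have k1 : Real.log (3 / 2 * v) ≤ Real.log (2 / 1.26) :=
      Real.log_le_log (by linarith) (by linarith)
    rw [Real.log_div (by norm_num) (by norm_num)] at k1
    have k2 := two_mul_sub_div_add_le_log (show (1 : ℝ) ≤ 1.26 by norm_num)
    norm_num at k1 k2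
    linarith [Real.log_two_lt_d9]
  have l4 := log_le_of_le (show 1 ≤ 2 * v - 2 / 3 by linarith)
    (show 2 * v - 2 / 3 ≤ 1.435 by linarith)
  norm_num at l1 l4
  have hprod : primeRecipSum t (Real.sqrt x) * primeRecipSum (Real.sqrt y) (x / t) ≤
      0.465 * 0.371 :=
    mul_le_mul (by linarith) (by linarith) (primeRecipSum_nonneg _ _) (by norm_num)
  norm_num at hprod
  linarith

theorem map_prime_eq_one (h : Confined q χ u x y J) (hd7 : orderOf χ = 7) (hJ2 : J = 2) {t : ℝ}
    (ht3 : t ^ 3 = y) {p : ℕ} (hp : p.Prime) (hpt : (p : ℝ) ≤ t) : χ (p : ZMod q) = 1 := by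
  have hinArc := h.inArc
  rw [hd7, hJ2] at hinArc
  have hp1 : (1 : ℝ) ≤ p := by exact_mod_cast hp.one_lt.le
  have h3 : (p : ℝ) ^ 3 ≤ y := by rw [← ht3]; gcongr
  have h2 : (p : ℝ) ^ 2 ≤ y := (pow_le_pow_right₀ hp1 (by norm_num)).trans h3
  have h1 : (p : ℝ) ≤ y := (le_self_pow₀ hp1 (by norm_num)).trans h3
  have b1 := hinArc p hp.one_lt.le h1
  have b2 := hinArc (p ^ 2) (Nat.pos_of_ne_zero (pow_ne_zero 2 hp.ne_zero))
    (by push_cast; exact h2)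
  have b3 := hinArc (p ^ 3) (Nat.pos_of_ne_zero (pow_ne_zero 3 hp.ne_zero))
    (by push_cast; exact h3)
  rw [Nat.cast_pow, map_pow] at b2 b3
  exact eq_one_of_inArc_seven_two b1 b2 b3

theorem card_filter_or_le {S : Finset ℕ} {P Q : ℕ → Prop} [DecidablePred P] [DecidablePred Q]
    [DecidablePred fun n => P n ∨ Q n] {a b : ℝ}
    (hP : ((S.filter P).card : ℝ) ≤ a) (hQ : ((S.filter Q).card : ℝ) ≤ b) :
    ((S.filter fun n => P n ∨ Q n).card : ℝ) ≤ a + b := by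
  have e : S.filter (fun n => P n ∨ Q n) = S.filter P ∪ S.filter Q := by
    ext n
    simp only [Finset.mem_filter, Finset.mem_union]
    tauto
  rw [e]
  refine le_trans ?_ (add_le_add hP hQ)
  exact_mod_cast Finset.card_union_le _ _

/-- The configuration `d = 7`, `J = 2` is impossible as well: after the exceptional integers have
been discarded, a proportion of more than `5/7` lies in an arc of `5` out of `7` values. -/
theorem not_confined (h : Confined q χ u x y J) : False := by
  classical
  obtain ⟨hd7, hJ2⟩ := h.order_eq_seven
  have hu := h.u_lt_of_eq_two hd7 hJ2
  have cube : ∀ z : ℝ, 0 < z → Real.exp (Real.log z / 3) ^ 3 = z := fun z hz => by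
    rw [← Real.exp_nat_mul]
    push_cast
    rw [mul_div_cancel₀ _ (by norm_num : (3 : ℝ) ≠ 0), Real.exp_log hz]
  obtain ⟨t, ht0, htl, ht3⟩ : ∃ t : ℝ, 0 < t ∧ Real.log t = Real.log y / 3 ∧ t ^ 3 = y :=
    ⟨_, Real.exp_pos _, Real.log_exp _, cube y h.y_pos⟩
  obtain ⟨x₃, hx0, hxl, hx3⟩ : ∃ x₃ : ℝ, 0 < x₃ ∧ Real.log x₃ = Real.log x / 3 ∧ x₃ ^ 3 = x :=
    ⟨_, Real.exp_pos _, Real.log_exp _, cube x h.x_pos⟩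
  have hσ := h.exceptional_sum_le hu ht0 hx0 htl hxl
  have hinArc := h.inArc
  rw [hd7, hJ2] at hinArc
  have hc1 := card_exists_prime_dvd_le ht0.le x₃ ⌊x⌋₊
  have hc2 := card_exists_prime_mul_dvd_le ht0.le (Real.sqrt_nonneg y) (Real.sqrt x) (x / t) ⌊x⌋₊
  have hbound := h.one_sub_le (M := 2) _
    ((card_filter_or_le hc1 hc2).trans_eq (mul_add _ _ _).symm) (fun n hn hnx hs hb => by
    rw [not_or] at hb
    rw [hd7]
    exact inArc_seven_two (f := fun n : ℕ => χ (n : ZMod q)) (map_mul χ) (map_one χ) ht0 hx3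
      hx0.le hinArc (fun p hp hpt => h.map_prime_eq_one hd7 hJ2 ht3 hp hpt) hn hnx hs hb.1 hb.2)
  rw [hd7] at hbound
  have hS1 := h.primeRecipSum_y_x_le
  have l1 := log_le_of_le (show 1 ≤ u / 2 by linarith [h.two_lt])
    (show u / 2 ≤ 1.05 by linarith)
  norm_num at l1 hbound
  linarith [h.rho_le]

end Confined

/-! ### Choice of parameters -/

theorem one_add_sq_le_mul_pow_four {a : ℝ} (ha : 200 ≤ a) : (1 + a) ^ 2 ≤ 0.00025 * a ^ 4 := by
  have h1 : 1 + a ≤ 2 * a := by linarith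
  have h2 : (200 : ℝ) ^ 2 ≤ a ^ 2 := by gcongr
  calc (1 + a) ^ 2 ≤ (2 * a) ^ 2 := by gcongr
    _ = 0.0001 * (200 ^ 2 * a ^ 2) := by ring
    _ ≤ 0.0001 * (a ^ 2 * a ^ 2) := by gcongr
    _ ≤ 0.00025 * a ^ 4 := by nlinarith [sq_nonneg (a ^ 2)]

/-- For large `q`, values `χ n` with `|unitArg (χ n)| < ρ(u)` for all `n ≤ q^{1/u}` yield a confined
configuration. The range is `x = √q (log q)^5`: the power of the logarithm makes the
Pólya--Vinogradov error a small fraction of `ρ(u) x`, and changes `2 log x / log y` from `u` by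
`O(u log log q / log q)` only. -/
theorem confined_of_forall_abs_unitArg_lt {q : ℕ} (hq : q.Prime) {χ : DirichletCharacter ℂ q}
    {u : ℝ} (hL2 : 1 ≤ Real.log (Real.log q)) (hL : 10 ^ 5 * Real.log (Real.log q) ^ 3 ≤ Real.log q)
    (hu : 2 < u) (hu4 : 4 * u ≤ Real.log (Real.log q))
    (hul : 2 * u * Real.log (2 * u) ≤ Real.log (Real.log q))
    (hd : 1 < orderOf χ * dickmanRho u)
    (harg : ∀ n : ℕ, 1 ≤ n → (n : ℝ) ≤ (q : ℝ) ^ (1 / u) →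
      |unitArg (χ (n : ZMod q))| < dickmanRho u) :
    Confined q χ u (Real.sqrt q * Real.log q ^ 5) ((q : ℝ) ^ (1 / u))
      (⌈orderOf χ * dickmanRho u⌉₊ - 1) := by
  set ℓ := Real.log q with hℓ
  set L := Real.log ℓ with hLdef
  have hq0 : (0 : ℝ) < q := by exact_mod_cast hq.pos
  have hL0 : 0 ≤ L := by linarith
  have hL1 : 1 ≤ L ^ 2 := one_le_pow₀ hL2
  have hL3 : L ≤ L ^ 3 := le_self_pow₀ hL2 (by norm_num)
  have hL23 : L ^ 2 ≤ L ^ 3 := pow_le_pow_right₀ hL2 (by norm_num)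
  have hℓ5 : 10 ^ 5 ≤ ℓ := by linarith
  have hℓ0 : 0 < ℓ := by linarith
  have hu0 : 0 < u := by linarith
  set x := Real.sqrt q * ℓ ^ 5 with hx
  set y := (q : ℝ) ^ (1 / u) with hy
  have hsq : 0 < Real.sqrt q := Real.sqrt_pos.2 hq0
  have hx0 : 0 < x := by positivity
  have hy0 : 0 < y := Real.rpow_pos_of_pos hq0 _
  have hlogx : Real.log x = ℓ / 2 + 5 * L := by
    rw [hx, Real.log_mul hsq.ne' (by positivity), Real.log_sqrt hq0.le, Real.log_pow]
    push_cast
    ring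
  have hlogy : Real.log y = ℓ / u := by
    rw [hy, Real.log_rpow hq0]
    ring
  have hxℓ : Real.log x < ℓ := by rw [hlogx]; linarith
  have hxq : x < q := (Real.log_lt_log_iff hx0 hq0).1 hxℓ
  have hw : 2 * (Real.log x / Real.log y) = u + 10 * u * L / ℓ := by
    rw [hlogx, hlogy]
    field_simp
    ring
  have hyx : y ≤ x := by
    rw [← Real.log_le_log_iff hy0 hx0, hlogx, hlogy, div_le_iff₀ hu0]
    nlinarith only [mul_nonneg hL0 hu0.le, mul_le_mul_of_nonneg_left hu.le hℓ0.le]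
  have hρ : ℓ⁻¹ ≤ dickmanRho u := by
    refine le_trans ?_ (exp_neg_le_dickmanRho (by linarith : (1 : ℝ) ≤ u))
    rw [← Real.exp_log hℓ0, ← Real.exp_neg]
    exact Real.exp_le_exp.2 (by linarith)
  have hρ0 := dickmanRho_pos u
  have huL : 16 * u ^ 2 ≤ L ^ 2 := by
    rw [show 16 * u ^ 2 = (4 * u) ^ 2 by ring]
    gcongr
  have hlogy_ge : 4 * 10 ^ 5 * L ^ 2 ≤ Real.log y := by
    rw [hlogy, le_div_iff₀ hu0]
    linarith [mul_le_mul_of_nonneg_left hu4 (sq_nonneg L), pow_succ L 2]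
  have hx1 : 1 ≤ x := by
    have h1 : 1 ≤ Real.log y := by linarith
    have h2 : y ≠ 0 := hy0.ne'
    have h3 := Real.log_le_sub_one_of_pos hy0
    linarith
  have hd0 : 0 < orderOf χ := by
    rcases Nat.eq_zero_or_pos (orderOf χ) with h | h
    · rw [h] at hd
      norm_num at hd
    · exact h
  refine ⟨hq, hu, hd, ?_, hy0, by linarith, hx0, hxq, ?_, ?_, ?_, ?_, fun n hn hny => ?_⟩
  · have h1 : 0 < ⌈orderOf χ * dickmanRho u⌉₊ := Nat.ceil_pos.2 (by linarith)
    rw [Nat.cast_pred h1]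
    linarith [Nat.ceil_lt_add_one (show 0 ≤ (orderOf χ : ℝ) * dickmanRho u by linarith)]
  · rw [hw]
    have : 0 ≤ 10 * u * L / ℓ := by positivity
    linarith
  · rw [hw, show 4 * u * (u + 10 * u * L / ℓ - u) = 40 * u ^ 2 * L / ℓ by ring,
      div_le_iff₀ hℓ0]
    linarith [mul_le_mul_of_nonneg_right huL hL0, pow_succ L 2]
  · rw [hlogy, div_pow, le_div_iff₀ (by positivity)]
    have h1 : 64 * u ^ 2 ≤ ℓ := by linarith
    calc 64 * Real.log x * u ^ 2 ≤ 64 * ℓ * u ^ 2 := by gcongr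
      _ = ℓ * (64 * u ^ 2) := by ring
      _ ≤ ℓ * ℓ := by gcongr
      _ = ℓ ^ 2 := (sq ℓ).symm
  · have hfl : x / 2 ≤ ⌊x⌋₊ := by
      have h1 := Nat.lt_floor_add_one x
      have h2 : (1 : ℝ) ≤ ⌊x⌋₊ := by exact_mod_cast (Nat.one_le_floor_iff x).2 hx1
      linarith
    calc Real.sqrt q * (1 + ℓ) ^ 2 ≤ Real.sqrt q * (0.00025 * ℓ ^ 4) := by
          gcongr
          exact one_add_sq_le_mul_pow_four (by linarith)
      _ = 0.0005 * ℓ⁻¹ * (x / 2) := by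
          rw [hx]
          field_simp
          norm_num
      _ ≤ 0.0005 * dickmanRho u * ⌊x⌋₊ := by gcongr
  · have hnq : n < q := by exact_mod_cast lt_of_le_of_lt (hny.trans hyx) hxq
    exact inArc_of_abs_unitArg_lt hd0 (dirichletCharacter_pow_orderOf hq χ hn hnq) (harg n hn hny)

/-- The growth condition on `g` keeps `2u log (2u)` below `log log q`, and thereby `ρ(u)` above
`1 / log q`. -/
theorem eventually_log_log (g : ℕ → ℝ)
    (hg : g =o[atTop] fun q : ℕ =>
      Real.log (Real.log (q : ℝ)) / Real.log (Real.log (Real.log (q : ℝ)))) :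
    ∀ᶠ q : ℕ in atTop, 1 ≤ Real.log (Real.log (q : ℝ)) ∧
      10 ^ 5 * Real.log (Real.log (q : ℝ)) ^ 3 ≤ Real.log q ∧
      ∀ u : ℝ, 2 < u → u ≤ g q → 4 * u ≤ Real.log (Real.log (q : ℝ)) ∧
        2 * u * Real.log (2 * u) ≤ Real.log (Real.log (q : ℝ)) := by
  have t1 : Tendsto (fun q : ℕ => Real.log (q : ℝ)) atTop atTop :=
    Real.tendsto_log_atTop.comp tendsto_natCast_atTop_atTop
  have t2 := Real.tendsto_log_atTop.comp t1
  have t3 := Real.tendsto_log_atTop.comp t2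
  have h3 := (Real.isLittleO_pow_log_id_atTop (n := 3)).bound
    (show (0 : ℝ) < 1 / 10 ^ 5 by norm_num)
  filter_upwards [t1.eventually_ge_atTop 1, t2.eventually_ge_atTop 1, t3.eventually_ge_atTop 1,
    t1.eventually h3, hg.bound (show (0 : ℝ) < 1 / 4 by norm_num)] with q e1 e2 e3 e4 e5
  simp only [Function.comp_apply] at e2 e3
  simp only [id, Real.norm_eq_abs] at e4 e5
  set L := Real.log (Real.log (q : ℝ))
  set L' := Real.log L
  have hL' : 0 < L' := by linarith
  refine ⟨e2, ?_, fun u hu hug => ?_⟩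
  · rw [abs_of_nonneg (by positivity), abs_of_nonneg (by linarith)] at e4
    linarith
  · rw [abs_of_nonneg (a := L / L') (by positivity)] at e5
    have h1 : 4 * u ≤ L / L' := by linarith [le_abs_self (g q)]
    have h2 : L / L' ≤ L := div_le_self (by linarith) e3
    have h3 : Real.log (2 * u) ≤ L' := Real.log_le_log (by linarith) (by linarith)
    refine ⟨h1.trans h2, ?_⟩
    rw [le_div_iff₀ hL'] at h1
    nlinarith [mul_le_mul_of_nonneg_left h3 (show 0 ≤ 2 * u by linarith),
      mul_pos (by linarith : 0 < u) hL']

theorem mainTheorem10 (g : ℕ → ℝ)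
    (hg : g =o[atTop] fun q : ℕ =>
      Real.log (Real.log (q : ℝ)) / Real.log (Real.log (Real.log (q : ℝ)))) :
    ∀ᶠ q : ℕ in atTop, q.Prime →
      ∀ δ : ℝ, 0 < δ → δ < 1 / 2 → 1 / δ ≤ g q →
      ∀ d : ℕ, 2 ≤ d →
      ∀ χ : DirichletCharacter ℂ q, χ.IsPrimitive → orderOf χ = d →
        (dickmanRho (1 / δ))⁻¹ < (d : ℝ) →
      ∀ c : ℝ, 1 < c →
        ∃ n : ℕ, 1 ≤ n ∧ (n : ℝ) ≤ (q : ℝ) ^ δ ∧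
          max (1 / (d : ℝ)) (dickmanRho (1 / δ) ^ c) ≤ |unitArg (χ (n : ZMod q))| := by
  filter_upwards [eventually_log_log g hg] with q ⟨h1, h2, h3⟩ hq δ hδ0 hδ hδg d _ χ _ hχ hd c hc
  subst hχ
  have hu : 2 < 1 / δ := by
    rw [lt_div_iff₀ hδ0]
    linarith
  obtain ⟨h4, h5⟩ := h3 _ hu hδg
  have hρ := dickmanRho_pos (1 / δ)
  have hd' : 1 < orderOf χ * dickmanRho (1 / δ) := (inv_lt_iff_one_lt_mul₀ hρ).1 hd
  -- it is enough to find a value at distance at least `ρ(1/δ)` from `1`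
  have hmax : max (1 / (orderOf χ : ℝ)) (dickmanRho (1 / δ) ^ c) ≤ dickmanRho (1 / δ) := by
    refine max_le ?_ (Real.rpow_le_self_of_le_one hρ.le (dickmanRho_le_one _) hc.le)
    rw [one_div]
    exact (inv_le_of_inv_le₀ hρ hd.le)
  by_contra hcon
  push Not at hcon
  refine (confined_of_forall_abs_unitArg_lt hq h1 h2 hu h4 h5 hd' fun n hn hny => ?_).not_confined
  rw [one_div_one_div] at hny
  exact (hcon n hn hny).trans_le hmax
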